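/- A system is a weighted system $Az=b$ of $m$ linear equations in $n$ variables over $\mathbb{F}_2$ in which every equation contains at least one variable and has a positive integer weight. The excess of an assignment $z\in\mathbb{F}_2^n$ is the total weight of the equations it satisfies minus the total weight of the equations it falsifies. Max Lin AA is the following parameterized problem: given a system $Az=b$ and the parameter $k\in\mathbb{N}$, decide whether the maximum excess over all assignments is at least $k$. **Proposition.** Max Lin AA can be solved in time $O(m^{k+O(1)})$. Precisely: there are a program $P$ for the random access machine (registers and memory cells hold natural numbers; addition, truncated subtraction, halving, copying, indirect memory access and tests for zero cost one step each) and constants $C,c\in\mathbb{N}$ such that for all $n,m,k\in\mathbb{N}$ and every system of $m$ equations in $n$ variables, given to the machine as the sequence of the numbers $k,n,m$ and, for every equation, its coefficients, right-hand side and weight, $P$ halts with the correct answer; if $m\ge 1$, it does so after at most $C\,n^{c}m^{k+c}$ steps, and if moreover $n\le m$ (in particular, if $n=\operatorname{rank}A$), after at most $C\,m^{k+c}$ steps. Consequently Max Lin AA is in XP: with systems encoded as binary strings $x$ (the weights in binary), it can be decided whether $(x,k)$ is a yes-instance in time $|x|^{O(f(k))}$ for some computable function $f$. -/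

import Mathlib

namespace MaxLin

/-! ### Weighted linear systems over the field with two elements -/

/-- A weighted system `A z = b` of `m` linear equations in `n` variables over `𝔽₂`. The weights are
positive integers, and every equation contains at least one variable. -/
structure System (n m : ℕ) where
  /-- the coefficient matrix -/
  A : Matrix (Fin m) (Fin n) (ZMod 2)
  /-- the right-hand sides -/
  b : Fin m → ZMod 2
  /-- the weights of the equations -/
  w : Fin m → ℕ
  w_pos : ∀ j, 0 < w j
  row_ne_zero : ∀ j, ∃ i, A j i ≠ 0

namespace System

variable {n m : ℕ}

/-- The excess of an assignment: the total weight of the satisfied equations minus the total weight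
of the falsified ones. -/
def excess (S : System n m) (z : Fin n → ZMod 2) : ℤ :=
  (∑ j with S.A.mulVec z j = S.b j, (S.w j : ℤ)) - ∑ j with S.A.mulVec z j ≠ S.b j, (S.w j : ℤ)

/-- The maximum excess over all assignments. -/
def maxExcess (S : System n m) : ℤ :=
  Finset.univ.sup' Finset.univ_nonempty S.excess

/-- The system as a sequence of natural numbers: `n`, `m`, and then for every equation its `n`
coefficients, its right-hand side and its weight. -/
def toWords (S : System n m) : List ℕ :=
  [n, m] ++ (List.ofFn fun j =>
    (List.ofFn fun i => (S.A j i).val) ++ [(S.b j).val, S.w j]).flatten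

/-- The system as a bit string: `n` and `m` in unary (each closed by a `0`), and then for every
equation its `n` coefficients, its right-hand side and its weight in binary. A weight is written with
its least significant digit first, a `1` before every digit and a closing `0`. -/
def toBits (S : System n m) : List Bool :=
  List.replicate n true ++ [false] ++ (List.replicate m true ++ [false]) ++
    (List.ofFn fun j =>
      (List.ofFn fun i => decide (S.A j i = 1)) ++ [decide (S.b j = 1)] ++
        ((S.w j).bits.flatMap fun d => [true, d]) ++ [false]).flatten

end System

/-! ### Random access machines with uniform cost -/

/-- A configuration: registers and memory cells, each of them holding a natural number. (A program
mentions only finitely many registers; the memory is addressed indirectly.) -/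
structure State where
  reg : ℕ → ℕ
  mem : ℕ → ℕ

/-- Elementary instructions. There is no multiplication, so that a run of `t` steps lengthens
the binary expansions of the numbers involved by at most `t` digits (up to constants). -/
inductive Instr where
  /-- `r_d := c` -/
  | const (d c : ℕ)
  /-- `r_d := r_a` -/
  | copy (d a : ℕ)
  /-- `r_d := r_a + r_b` -/
  | add (d a b : ℕ)
  /-- `r_d := max (r_a - r_b) 0` -/
  | sub (d a b : ℕ)
  /-- `r_d := ⌊r_a / 2⌋` -/
  | half (d a : ℕ)
  /-- `r_d := mem[r_a]` -/
  | load (d a : ℕ)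
  /-- `mem[r_a] := r_b` -/
  | store (a b : ℕ)

/-- The effect of an elementary instruction. -/
def Instr.apply : Instr → State → State
  | .const d c, s => { s with reg := Function.update s.reg d c }
  | .copy d a, s => { s with reg := Function.update s.reg d (s.reg a) }
  | .add d a b, s => { s with reg := Function.update s.reg d (s.reg a + s.reg b) }
  | .sub d a b, s => { s with reg := Function.update s.reg d (s.reg a - s.reg b) }
  | .half d a, s => { s with reg := Function.update s.reg d (s.reg a / 2) }
  | .load d a, s => { s with reg := Function.update s.reg d (s.mem (s.reg a)) }
  | .store a b, s => { s with mem := Function.update s.mem (s.reg a) (s.reg b) }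

/-- Programs: elementary instructions, composition, branching on `0 < r_a`, and loops that run as
long as `0 < r_a`. -/
inductive Prog where
  | instr (i : Instr)
  | seq (P Q : Prog)
  | ifPos (a : ℕ) (P Q : Prog)
  | whilePos (a : ℕ) (P : Prog)

/-- `Exec P s t s'`: started in the configuration `s`, the program `P` halts after exactly `t` steps
in the configuration `s'`. Every elementary instruction and every test is one step. -/
inductive Exec : Prog → State → ℕ → State → Prop where
  | instr (i : Instr) (s : State) : Exec (.instr i) s 1 (i.apply s)
  | seq {P Q : Prog} {s₁ s₂ s₃ : State} {t u : ℕ} :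
      Exec P s₁ t s₂ → Exec Q s₂ u s₃ → Exec (.seq P Q) s₁ (t + u) s₃
  | ifTrue {a : ℕ} {P Q : Prog} {s s' : State} {t : ℕ} :
      0 < s.reg a → Exec P s t s' → Exec (.ifPos a P Q) s (t + 1) s'
  | ifFalse {a : ℕ} {P Q : Prog} {s s' : State} {t : ℕ} :
      s.reg a = 0 → Exec Q s t s' → Exec (.ifPos a P Q) s (t + 1) s'
  | whileTrue {a : ℕ} {P : Prog} {s₁ s₂ s₃ : State} {t u : ℕ} :
      0 < s₁.reg a → Exec P s₁ t s₂ → Exec (.whilePos a P) s₂ u s₃ →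
        Exec (.whilePos a P) s₁ (t + u + 1) s₃
  | whileFalse {a : ℕ} {P : Prog} {s : State} :
      s.reg a = 0 → Exec (.whilePos a P) s 1 s

/-- The initial configuration: the input is in the memory cells `0, 1, 2, …`, its length is in
register `0`, and everything else is `0`. -/
def State.start (x : List ℕ) : State where
  reg r := if r = 0 then x.length else 0
  mem i := x.getD i 0

/-- On input `x` the program `P` halts after exactly `t` steps and answers the yes/no question `q`
correctly; the answer "yes" is given by a positive number in register `0`. -/
def Prog.Answers (P : Prog) (x : List ℕ) (t : ℕ) (q : Prop) : Prop :=
  ∃ s, Exec P (State.start x) t s ∧ (0 < s.reg 0 ↔ q)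

/-! ### Parameterized problems -/

/-- The class XP: membership of `(x, k)` can be decided in time `|x| ^ O(f k)` for a
computable function `f`. (The `+ 2` only matters for `|x| ≤ 1`.) -/
def InXP (L : Set (List Bool × ℕ)) : Prop :=
  ∃ (P : Prog) (f : ℕ → ℕ), Computable f ∧ ∀ (x : List Bool) (k : ℕ), ∃ t : ℕ,
    P.Answers (k :: x.map Bool.toNat) t ((x, k) ∈ L) ∧ t ≤ (x.length + 2) ^ f k

/-- The parameterized problem Max Lin AA: `(x, k)` is a yes-instance if `x` encodes a weighted system
whose maximum excess is at least the parameter `k`. -/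
def maxLinAA : Set (List Bool × ℕ) :=
  {p | ∃ (n m : ℕ) (S : System n m), p.1 = S.toBits ∧ (p.2 : ℤ) ≤ S.maxExcess}

end MaxLin

set_option linter.unusedSimpArgs false

/-! Write the excess of `z` as a sum of signed weights, the sign of an equation being `+` when its
defect at `z` vanishes. Fix an equation `u` with pivot variable `p` and add it to every row
containing `p`. Assignments satisfying `u` keep their excess (`exc_elim`). Column `p` is then empty,
so any assignment can be changed at `p` to satisfy `u`, and every excess of the reduced system
occurs in the old one (`exists_exc_elim`). The rows that become constant are exactly those with the
left-hand side of `u`. If the right-hand side of `u` is chosen with the sign of their net weight,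
the constant part of the excess grows by the absolute value of that net weight (`net_step_of_ne`).

Soundness: the constant part never decreases under further elimination, and it is the whole excess
once no variable is left. So whatever constant a sequence of steps produces is reached by some
assignment (`exists_le_exc_of_run`).

Completeness: if the excess of `z` exceeds the constant part, then after grouping equations by
left-hand side some group contributes positively. Hence `z` satisfies the oriented equation of that
group, whose net weight is nonzero (`exists_orient_of_lt`). Eliminating with it preserves the excess
of `z`, raises the constant by at least one and empties a row. As the constant is `0` initially,
`min k m` steps suffice (`exists_run_of_le_exc`, `exists_le_exc_iff`).

The program tries all `m ^ min k m` sequences with a base-`m` counter (`wp_searchProg`). One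
sequence takes at most `m` steps, so its cost is polynomial in `n` and `m` with no factor depending
on `k`. Correctness and running time are proved together in a program logic whose stores carry a
step counter (`wp`). For bit strings a parser precedes the search. The encoding is uniquely
decodable (`encSystem_unique`), and a string is valid if and only if the parser consumes exactly
that string and finds only good rows. -/

namespace MaxLin

/-! ### Structured programs on top of the machine

Program variable `r` lives in register `2 * r`; the odd registers hold temporaries. -/

/-- Arithmetic expressions over program variables and memory cells. -/
inductive Ex where
  | num (c : ℕ)
  | var (r : ℕ)
  | add (a b : Ex)
  | sub (a b : Ex)
  | ld (a : Ex)

/-- Values of the program variables, the memory, and the number of steps made so far. -/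
structure Store where
  v : ℕ → ℕ
  mem : ℕ → ℕ
  time : ℕ

namespace Store

def set (σ : Store) (x a : ℕ) : Store := { σ with v := Function.update σ.v x a }

def put (σ : Store) (p a : ℕ) : Store := { σ with mem := Function.update σ.mem p a }

def tick (σ : Store) (t : ℕ) : Store := { σ with time := σ.time + t }

@[simp] theorem set_v (σ : Store) (x a : ℕ) : (σ.set x a).v = Function.update σ.v x a := rfl
@[simp] theorem set_mem (σ : Store) (x a : ℕ) : (σ.set x a).mem = σ.mem := rfl
@[simp] theorem set_time (σ : Store) (x a : ℕ) : (σ.set x a).time = σ.time := rfl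
@[simp] theorem put_v (σ : Store) (x a : ℕ) : (σ.put x a).v = σ.v := rfl
@[simp] theorem put_mem (σ : Store) (x a : ℕ) : (σ.put x a).mem = Function.update σ.mem x a := rfl
@[simp] theorem put_time (σ : Store) (x a : ℕ) : (σ.put x a).time = σ.time := rfl
@[simp] theorem tick_v (σ : Store) (t : ℕ) : (σ.tick t).v = σ.v := rfl
@[simp] theorem tick_mem (σ : Store) (t : ℕ) : (σ.tick t).mem = σ.mem := rfl
@[simp] theorem tick_time (σ : Store) (t : ℕ) : (σ.tick t).time = σ.time + t := rfl

/-- The variables below `p` have the same values in both stores. -/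
def Fr (p : ℕ) (σ τ : Store) : Prop := ∀ r < p, τ.v r = σ.v r

end Store

namespace Ex

def eval (σ : Store) : Ex → ℕ
  | num c => c
  | var r => σ.v r
  | add a b => a.eval σ + b.eval σ
  | sub a b => a.eval σ - b.eval σ
  | ld a => σ.mem (a.eval σ)

def cost : Ex → ℕ
  | num _ => 1
  | var _ => 1
  | add a b => a.cost + b.cost + 1
  | sub a b => a.cost + b.cost + 1
  | ld a => a.cost + 1

/-- Code that puts the value of an expression into the temporary number `d`. -/
def code (d : ℕ) : Ex → Prog
  | num c => .instr (.const (2 * d + 1) c)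
  | var r => .instr (.copy (2 * d + 1) (2 * r))
  | add a b => .seq (.seq (a.code d) (b.code (d + 1)))
      (.instr (.add (2 * d + 1) (2 * d + 1) (2 * (d + 1) + 1)))
  | sub a b => .seq (.seq (a.code d) (b.code (d + 1)))
      (.instr (.sub (2 * d + 1) (2 * d + 1) (2 * (d + 1) + 1)))
  | ld a => .seq (a.code d) (.instr (.load (2 * d + 1) (2 * d + 1)))

/-- The bitwise sum of two bits. -/
def xor (a b : Ex) : Ex := add (sub a b) (sub b a)

end Ex

/-- The store `σ` describes the machine configuration `s`. -/
def Rel (s : State) (σ : Store) : Prop := (∀ r, s.reg (2 * r) = σ.v r) ∧ s.mem = σ.mem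

/-- The temporaries form a stack: code at depth `d` leaves those below `d` alone, so the left
operand survives the evaluation of the right one. Program variables sit in even registers and are
never touched. -/
theorem Ex.exec_code (e : Ex) (σ : Store) : ∀ (d : ℕ) (s : State), Rel s σ →
    ∃ s', Exec (e.code d) s e.cost s' ∧ Rel s' σ ∧ s'.reg (2 * d + 1) = e.eval σ ∧
      ∀ d' < d, s'.reg (2 * d' + 1) = s.reg (2 * d' + 1) := by
  induction e with
  | num c =>
    intro d s h
    refine ⟨_, Exec.instr _ _, ⟨fun r => ?_, h.2⟩, ?_, fun d' hd => ?_⟩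
    · rw [← h.1 r]; exact Function.update_of_ne (by omega) _ _
    · simp [Instr.apply, Ex.eval]
    · exact Function.update_of_ne (by omega) _ _
  | var c =>
    intro d s h
    refine ⟨_, Exec.instr _ _, ⟨fun r => ?_, h.2⟩, ?_, fun d' hd => ?_⟩
    · rw [← h.1 r]; exact Function.update_of_ne (by omega) _ _
    · simp [Instr.apply, Ex.eval, h.1]
    · exact Function.update_of_ne (by omega) _ _
  | add a b iha ihb =>
    intro d s h
    obtain ⟨s₁, e₁, r₁, v₁, f₁⟩ := iha d s h
    obtain ⟨s₂, e₂, r₂, v₂, f₂⟩ := ihb (d + 1) s₁ r₁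
    refine ⟨_, (e₁.seq e₂).seq (Exec.instr _ _), ⟨fun r => ?_, r₂.2⟩, ?_, fun d' hd => ?_⟩
    · rw [← r₂.1 r]; exact Function.update_of_ne (by omega) _ _
    · simp [Instr.apply, Ex.eval, v₂, f₂ d (by omega), v₁]
    · rw [← f₁ d' hd, ← f₂ d' (by omega)]; exact Function.update_of_ne (by omega) _ _
  | sub a b iha ihb =>
    intro d s h
    obtain ⟨s₁, e₁, r₁, v₁, f₁⟩ := iha d s h
    obtain ⟨s₂, e₂, r₂, v₂, f₂⟩ := ihb (d + 1) s₁ r₁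
    refine ⟨_, (e₁.seq e₂).seq (Exec.instr _ _), ⟨fun r => ?_, r₂.2⟩, ?_, fun d' hd => ?_⟩
    · rw [← r₂.1 r]; exact Function.update_of_ne (by omega) _ _
    · simp [Instr.apply, Ex.eval, v₂, f₂ d (by omega), v₁]
    · rw [← f₁ d' hd, ← f₂ d' (by omega)]; exact Function.update_of_ne (by omega) _ _
  | ld a iha =>
    intro d s h
    obtain ⟨s₁, e₁, r₁, v₁, f₁⟩ := iha d s h
    refine ⟨_, e₁.seq (Exec.instr _ _), ⟨fun r => ?_, r₁.2⟩, ?_, fun d' hd => ?_⟩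
    · rw [← r₁.1 r]; exact Function.update_of_ne (by omega) _ _
    · simp [Instr.apply, Ex.eval, v₁, r₁.2]
    · rw [← f₁ d' hd]; exact Function.update_of_ne (by omega) _ _

/-! ### Total-correctness rules with step counts -/

/-- `P`, started in a configuration described by `σ`, halts in one described by a store with the
property `Q`. -/
def wp (P : Prog) (σ : Store) (Q : Store → Prop) : Prop :=
  ∀ s, Rel s σ → ∃ t s' σ', Exec P s t s' ∧ Rel s' σ' ∧ σ'.time = σ.time + t ∧ Q σ'

/-- `x := e` -/
def asg (x : ℕ) (e : Ex) : Prog := .seq (e.code 0) (.instr (.copy (2 * x) 1))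

/-- `mem[a] := e` -/
def sto (a e : Ex) : Prog := .seq (.seq (a.code 0) (e.code 1)) (.instr (.store 1 3))

/-- branching on `0 < e` -/
def ite (e : Ex) (P Q : Prog) : Prog := .seq (e.code 0) (.ifPos 1 P Q)

/-- `while 0 < e do P` -/
def whl (e : Ex) (P : Prog) : Prog := .seq (e.code 0) (.whilePos 1 (.seq P (e.code 0)))

def skip : Prog := .instr (.const 1 0)

/-- `for x := 0 to y - 1 do P` -/
def loop (x y : ℕ) (P : Prog) : Prog :=
  .seq (asg x (.num 0)) (whl (.sub (.var y) (.var x)) (.seq P (asg x (.add (.var x) (.num 1)))))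

theorem wp.mono {P : Prog} {σ : Store} {Q R : Store → Prop} (h : wp P σ Q)
    (hQ : ∀ σ', Q σ' → R σ') : wp P σ R := fun s hs => by
  obtain ⟨t, s', σ', a, b, c, d⟩ := h s hs
  exact ⟨t, s', σ', a, b, c, hQ _ d⟩

theorem wp_seq {P P' : Prog} {σ : Store} {Q : Store → Prop} (h : wp P σ fun σ' => wp P' σ' Q) :
    wp (.seq P P') σ Q := fun s hs => by
  obtain ⟨t, s', σ', a, b, c, d⟩ := h s hs
  obtain ⟨t', s'', σ'', a', b', c', d'⟩ := d s' b
  exact ⟨t + t', s'', σ'', a.seq a', b', by omega, d'⟩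

theorem wp_skip {σ : Store} {Q : Store → Prop} (h : Q (σ.tick 1)) : wp skip σ Q := fun s hs =>
  ⟨1, _, σ.tick 1, Exec.instr _ _,
    ⟨fun r => (Function.update_of_ne (by omega) _ _).trans (hs.1 r), hs.2⟩, rfl, h⟩

theorem wp_asg {x : ℕ} {e : Ex} {σ : Store} {Q : Store → Prop}
    (h : Q ((σ.set x (e.eval σ)).tick (e.cost + 1))) : wp (asg x e) σ Q := fun s hs => by
  obtain ⟨s', a, b, c, -⟩ := e.exec_code σ 0 s hs
  refine ⟨_, _, (σ.set x (e.eval σ)).tick (e.cost + 1), a.seq (Exec.instr _ _),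
    ⟨fun r => ?_, b.2⟩, rfl, h⟩
  by_cases hr : r = x
  · subst hr; simpa [Instr.apply] using c
  · simp only [Instr.apply, Store.tick_v, Store.set_v]
    rw [Function.update_of_ne (by omega), Function.update_of_ne hr, b.1]

theorem wp_sto {a e : Ex} {σ : Store} {Q : Store → Prop}
    (h : Q ((σ.put (a.eval σ) (e.eval σ)).tick (a.cost + e.cost + 1))) :
    wp (sto a e) σ Q := fun s hs => by
  obtain ⟨s₁, e₁, r₁, v₁, -⟩ := a.exec_code σ 0 s hs
  obtain ⟨s₂, e₂, r₂, v₂, f₂⟩ := e.exec_code σ 1 s₁ r₁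
  refine ⟨_, _, (σ.put (a.eval σ) (e.eval σ)).tick (a.cost + e.cost + 1),
    (e₁.seq e₂).seq (Exec.instr _ _), ⟨fun r => r₂.1 r, ?_⟩, rfl, h⟩
  have h₁ := f₂ 0 (by omega)
  simp only [Nat.mul_zero, Nat.zero_add, Nat.mul_one] at h₁ v₁ v₂
  simp [Instr.apply, h₁, v₁, v₂, r₂.2]

theorem wp_ite {e : Ex} {P P' : Prog} {σ : Store} {Q : Store → Prop}
    (h₁ : 0 < e.eval σ → wp P (σ.tick (e.cost + 1)) Q)
    (h₂ : e.eval σ = 0 → wp P' (σ.tick (e.cost + 1)) Q) : wp (ite e P P') σ Q := fun s hs => by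
  obtain ⟨s', a, b, c, -⟩ := e.exec_code σ 0 s hs
  simp only [Nat.mul_zero, Nat.zero_add] at c
  rcases Nat.eq_zero_or_pos (e.eval σ) with h | h
  · obtain ⟨t, s'', σ'', x, y, z, w⟩ := h₂ h s' b
    exact ⟨_, _, _, a.seq (.ifFalse (c.trans h) x), y, by simp at z; omega, w⟩
  · obtain ⟨t, s'', σ'', x, y, z, w⟩ := h₁ h s' b
    exact ⟨_, _, _, a.seq (.ifTrue (c ▸ h) x), y, by simp at z; omega, w⟩

theorem wp_whl_done {e : Ex} {P : Prog} {σ : Store} {Q : Store → Prop}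
    (h : e.eval σ = 0) (hQ : Q (σ.tick (e.cost + 1))) : wp (whl e P) σ Q := fun s hs => by
  obtain ⟨s', a, b, c, -⟩ := e.exec_code σ 0 s hs
  exact ⟨_, _, σ.tick (e.cost + 1), a.seq (.whileFalse (c.trans h)), b, rfl, hQ⟩

theorem wp_whl_step {e : Ex} {P : Prog} {σ : Store} {Q : Store → Prop}
    (h : 0 < e.eval σ) (hQ : wp P (σ.tick (e.cost + 1)) fun σ' => wp (whl e P) σ' Q) :
    wp (whl e P) σ Q := fun s hs => by
  obtain ⟨s', a, b, c, -⟩ := e.exec_code σ 0 s hs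
  simp only [Nat.mul_zero, Nat.zero_add] at c
  obtain ⟨t, s'', σ'', x, y, z, w⟩ := hQ s' b
  obtain ⟨t', s₃, σ₃, x', y', z', w'⟩ := w s'' y
  -- The remaining run of `whl` starts by evaluating the test. Splitting it off lets this evaluation
  -- serve as the one at the end of the loop body.
  cases x' with
  | seq x₁ x₂ =>
    exact ⟨_, _, _, a.seq (.whileTrue (c ▸ h) (x.seq x₁) x₂), y', by simp at z; omega, w'⟩

/-- The rule for a loop that is run through exactly `N` times. -/
theorem wp_whl {e : Ex} {P : Prog} {Q : Store → Prop} (N T : ℕ) (I : ℕ → Store → Prop)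
    (htick : ∀ i σ t, I i σ → I i (σ.tick t))
    (hstep : ∀ i < N, ∀ σ, I i σ → 0 < e.eval σ ∧
      wp P σ fun τ => I (i + 1) τ ∧ τ.time ≤ σ.time + T)
    {σ : Store} (hinit : I 0 σ)
    (hpost : ∀ τ, I N τ → e.eval τ = 0 ∧
      ∀ t, t ≤ σ.time + N * (T + e.cost + 1) + e.cost + 1 → Q { τ with time := t }) :
    wp (whl e P) σ Q := by
  -- Induction on the number `d` of rounds still to come, with the time spent so far as part of the
  -- invariant.
  suffices H : ∀ d i σ', i + d = N → I i σ' → σ'.time ≤ σ.time + i * (T + e.cost + 1) →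
      wp (whl e P) σ' Q from H N 0 σ (by omega) hinit (by omega)
  intro d
  induction d with
  | zero =>
    intro i σ' hi hI ht
    obtain rfl : i = N := by omega
    obtain ⟨h₁, h₂⟩ := hpost σ' hI
    exact wp_whl_done h₁ (h₂ (σ'.time + (e.cost + 1)) (by omega))
  | succ d ih =>
    intro i σ' hi hI ht
    refine wp_whl_step (hstep i (by omega) σ' hI).1 ?_
    refine (hstep i (by omega) _ (htick _ _ _ hI)).2.mono fun τ hτ => ?_
    refine ih (i + 1) τ (by omega) hτ.1 ?_
    have := hτ.2
    simp only [Store.tick_time] at this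
    rw [Nat.add_mul]
    omega

/-- The rule for a `for`-loop that changes only variables from number `p` on. -/
theorem wp_loop {x y : ℕ} {P : Prog} {σ : Store} {Q : Store → Prop} (p T : ℕ)
    (I : ℕ → (ℕ → ℕ) → (ℕ → ℕ) → Prop) (hx : p ≤ x) (hy : y < p)
    (hinit : I 0 (Function.update σ.v x 0) σ.mem)
    (hstep : ∀ i < σ.v y, ∀ σ₁, σ.Fr p σ₁ → σ₁.v x = i → I i σ₁.v σ₁.mem →
      wp P σ₁ fun σ₂ => σ₁.Fr p σ₂ ∧ σ₂.v x = i ∧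
        I (i + 1) (Function.update σ₂.v x (i + 1)) σ₂.mem ∧ σ₂.time ≤ σ₁.time + T)
    (hpost : ∀ τ, σ.Fr p τ → I (σ.v y) τ.v τ.mem →
      τ.time ≤ σ.time + (σ.v y * (T + 8) + 6) → Q τ) :
    wp (loop x y P) σ Q := by
  have hxy : y ≠ x := by omega
  refine wp_seq (wp_asg ?_)
  -- Incrementing the counter costs 4 steps and each test another 4, hence `T + 8` per round;
  -- initialization (2) and the last test (4) give the final `6`.
  refine wp_whl (σ.v y) (T + 4) (fun i τ => i ≤ σ.v y ∧ σ.Fr p τ ∧ τ.v x = i ∧ I i τ.v τ.mem)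
    (fun i τ t h => h) ?_ ⟨Nat.zero_le _, fun r hr => ?_, ?_, hinit⟩ ?_
  · rintro i hi τ ⟨-, h₁, h₂, h₃⟩
    have hyv := h₁ y hy
    refine ⟨by simp only [Ex.eval]; omega, wp_seq ((hstep i hi τ h₁ h₂ h₃).mono ?_)⟩
    rintro τ' ⟨h₄, h₅, h₆, h₇⟩
    refine wp_asg ⟨⟨hi, fun r hr => ?_, ?_, ?_⟩, ?_⟩
    · simp only [Store.tick_v, Store.set_v]
      rw [Function.update_of_ne (by omega), h₄ r hr, h₁ r hr]
    · simp [Ex.eval, h₅]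
    · simpa [Ex.eval, h₅] using h₆
    · simp [Ex.cost]; omega
  · exact Function.update_of_ne (by omega) _ _
  · simp [Ex.eval]
  · rintro τ ⟨-, h₁, h₂, h₃⟩
    refine ⟨by simp [Ex.eval, h₁ y hy, h₂], fun t ht => hpost _ h₁ h₃ ?_⟩
    simp only [Store.tick_time, Store.set_time, Ex.cost] at ht
    show t ≤ _
    have : σ.v y * (T + 4 + (1 + 1 + 1) + 1) = σ.v y * (T + 8) := by ring
    omega

/-! ### Elimination steps

The augmented matrix of a system is a function `M : ℕ → ℕ → ZMod 2`: row `i < m` has the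
coefficients `M i c` for `c < n` and the right-hand side `M i n`. -/

/-- The sign belonging to an element of the field with two elements. -/
def sgn (a : ZMod 2) : ℤ := if a = 0 then 1 else -1

theorem sgn_add (a b : ZMod 2) : sgn (a + b) = sgn a * sgn b := by
  revert a b; decide

theorem sgn_one_add (a : ZMod 2) : sgn (1 + a) = -sgn a := by
  revert a; decide

theorem zmod2_eq_one {a : ZMod 2} (h : a ≠ 0) : a = 1 := by
  revert a; decide

theorem zmod2_add_self (a : ZMod 2) : a + a = 0 := CharTwo.add_self_eq_zero a

/-- `⟨r, z⟩` plus the right-hand side of `r`; it vanishes if and only if `z` satisfies `r`. -/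
def defect (n : ℕ) (r z : ℕ → ZMod 2) : ZMod 2 := ∑ c ∈ Finset.range n, r c * z c + r n

/-- The excess of the assignment `z`. -/
def exc (n m : ℕ) (w : ℕ → ℕ) (M : ℕ → ℕ → ZMod 2) (z : ℕ → ZMod 2) : ℤ :=
  ∑ i ∈ Finset.range m, w i * sgn (defect n (M i) z)

/-- The net weight of the equations that have the left-hand side of `u`: those with the right-hand
side of `u` count positively, the others negatively. -/
def net (n m : ℕ) (w : ℕ → ℕ) (M : ℕ → ℕ → ZMod 2) (u : ℕ → ZMod 2) : ℤ :=
  ∑ i ∈ Finset.range m, if ∀ c < n, M i c = u c then w i * sgn (M i n + u n) else 0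

/-- The equation `u`, with its right-hand side changed if its net weight is negative. -/
def orient (n m : ℕ) (w : ℕ → ℕ) (M : ℕ → ℕ → ZMod 2) (u : ℕ → ZMod 2) : ℕ → ZMod 2 :=
  if net n m w M u < 0 then Function.update u n (1 + u n) else u

/-- Adding the row `u` to all rows with a nonzero entry in column `p`. -/
def elim (M : ℕ → ℕ → ZMod 2) (u : ℕ → ZMod 2) (p : ℕ) : ℕ → ℕ → ZMod 2 :=
  fun i c => if M i p = 0 then M i c else M i c + u c

/-- One more than the last index below `n` at which `u` does not vanish, and `0` if there is
none. -/
def lastIdx (u : ℕ → ZMod 2) : ℕ → ℕ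
  | 0 => 0
  | n + 1 => if u n = 0 then lastIdx u n else n + 1

/-- Substituting the equation number `j`, in its better version. -/
def step (n m : ℕ) (w : ℕ → ℕ) (M : ℕ → ℕ → ZMod 2) (j : ℕ) : ℕ → ℕ → ZMod 2 :=
  if lastIdx (M j) n = 0 then M else elim M (orient n m w M (M j)) (lastIdx (M j) n - 1)

/-- The first `t` steps with the equations `f 0`, `f 1`, … -/
def run (n m : ℕ) (w : ℕ → ℕ) (M : ℕ → ℕ → ZMod 2) (f : ℕ → ℕ) : ℕ → ℕ → ℕ → ZMod 2
  | 0 => M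
  | t + 1 => step n m w (run n m w M f t) (f t)

/-! ### Soundness and completeness of sequences of elimination steps -/

section

variable {n m : ℕ} {w : ℕ → ℕ} {M : ℕ → ℕ → ZMod 2} {u : ℕ → ZMod 2}

theorem lastIdx_eq_zero : ∀ {n : ℕ}, lastIdx u n = 0 ↔ ∀ c < n, u c = 0
  | 0 => by simp [lastIdx]
  | n + 1 => by
    rw [lastIdx, Nat.forall_lt_succ_right]
    split_ifs with h
    · simp [lastIdx_eq_zero, h]
    · simp [h]

theorem lastIdx_spec : ∀ {n : ℕ}, lastIdx u n ≠ 0 → lastIdx u n - 1 < n ∧ u (lastIdx u n - 1) ≠ 0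
  | 0 => by simp [lastIdx]
  | n + 1 => by
    rw [lastIdx]
    split_ifs with h
    · intro h'; exact ⟨(lastIdx_spec h').1.trans (Nat.lt_succ_self n), (lastIdx_spec h').2⟩
    · intro; simpa using h

theorem orient_of_lt {c : ℕ} (h : c < n) : orient n m w M u c = u c := by
  unfold orient; split_ifs
  · exact Function.update_of_ne h.ne _ _
  · rfl

theorem net_update : net n m w M (Function.update u n (1 + u n)) = -net n m w M u := by
  unfold net
  rw [← Finset.sum_neg_distrib]
  refine Finset.sum_congr rfl fun i _ => ?_
  have : (∀ c < n, M i c = Function.update u n (1 + u n) c) ↔ ∀ c < n, M i c = u c :=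
    forall₂_congr fun c hc => by rw [Function.update_of_ne hc.ne]
  simp only [this, Function.update_self]
  split_ifs
  · rw [add_left_comm, sgn_one_add]; ring
  · simp

theorem net_orient : net n m w M (orient n m w M u) = |net n m w M u| := by
  unfold orient; split_ifs with h
  · rw [net_update, abs_of_neg h]
  · rw [abs_of_nonneg (not_lt.1 h)]

theorem defect_add (r z : ℕ → ZMod 2) :
    defect n (fun c => r c + u c) z = defect n r z + defect n u z := by
  simp only [defect, add_mul, Finset.sum_add_distrib]; ring

theorem defect_congr {r z z' : ℕ → ZMod 2} (h : ∀ c < n, r c = 0 ∨ z c = z' c) :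
    defect n r z = defect n r z' := by
  unfold defect
  congr 1
  refine Finset.sum_congr rfl fun c hc => ?_
  rcases h c (Finset.mem_range.1 hc) with h | h <;> simp [h]

theorem defect_of_eq {r r' z : ℕ → ZMod 2} (h : ∀ c < n, r c = r' c) :
    defect n r z = defect n r' z + (r n + r' n) := by
  unfold defect
  rw [Finset.sum_congr rfl fun c hc => by rw [h c (Finset.mem_range.1 hc)]]
  linear_combination -(zmod2_add_self (r' n))

/-- Elimination does not change the excess of the assignments that satisfy the equation. -/
theorem exc_elim {z : ℕ → ZMod 2} (hz : defect n u z = 0) (p : ℕ) :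
    exc n m w (elim M u p) z = exc n m w M z := by
  refine Finset.sum_congr rfl fun i _ => ?_
  congr 2
  by_cases h : M i p = 0
  · rw [show elim M u p i = M i from funext fun c => if_pos h]
  · rw [show elim M u p i = fun c => M i c + u c from funext fun c => if_neg h, defect_add, hz,
      add_zero]

/-- Column `p` vanishes after the elimination, so `z p` is free and can be chosen to make `u` true;
then `exc_elim` applies. -/
theorem exists_exc_elim {p : ℕ} (hp : p < n) (hu : u p ≠ 0) (z : ℕ → ZMod 2) :
    ∃ z', exc n m w M z' = exc n m w (elim M u p) z := by
  have key : ∀ a, exc n m w (elim M u p) (Function.update z p a) = exc n m w (elim M u p) z := by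
    intro a
    refine Finset.sum_congr rfl fun i _ => ?_
    congr 2
    refine defect_congr fun c _ => ?_
    by_cases hc : c = p
    · left
      subst hc
      by_cases h : M i c = 0
      · simp [elim, h]
      · simp [elim, zmod2_eq_one h, zmod2_eq_one hu, zmod2_add_self]
    · right; exact Function.update_of_ne hc _ _
  have hd : ∀ a, defect n u (Function.update z p a) = defect n u (Function.update z p 0) + a := by
    intro a
    simp only [defect]
    rw [← Finset.sum_erase_add _ _ (Finset.mem_range.2 hp),
      ← Finset.sum_erase_add _ _ (Finset.mem_range.2 hp),
      Finset.sum_congr rfl (g := fun c => u c * Function.update z p 0 c) fun c hc => by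
        rw [Function.update_of_ne (Finset.ne_of_mem_erase hc),
          Function.update_of_ne (Finset.ne_of_mem_erase hc)]]
    simp [zmod2_eq_one hu]; ring
  -- By `hd` the defect of `u` is its value at `z p = 0` plus the new entry, so this entry cancels
  -- it.
  refine ⟨Function.update z p (defect n u (Function.update z p 0)), ?_⟩
  rw [← exc_elim (u := u) (p := p), key]
  rw [hd, zmod2_add_self]

/-- A row without `p` is unchanged and cannot share the left-hand side of `u`. A row with `p` was
nonzero and becomes zero exactly if its left-hand side is that of `u`. So the two net weights on the
right count disjoint sets of rows. -/
theorem net_elim {p : ℕ} (hp : p < n) (hu : u p ≠ 0) :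
    net n m w (elim M u p) 0 = net n m w M 0 + net n m w M u := by
  unfold net
  rw [← Finset.sum_add_distrib]
  refine Finset.sum_congr rfl fun i _ => ?_
  by_cases h : M i p = 0
  · have h₁ : ¬ ∀ c < n, M i c = u c := fun h' => hu (by rw [← h' p hp, h])
    simp [elim, h, h₁]
  · have h₁ : ¬ ∀ c < n, M i c = 0 := fun h' => h (h' p hp)
    have h₂ : ∀ a b : ZMod 2, a + b = 0 ↔ a = b := by decide
    simp [elim, h, h₁, h₂]

theorem net_step_of_ne {j : ℕ} (hj : lastIdx (M j) n ≠ 0) :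
    net n m w (step n m w M j) 0 = net n m w M 0 + |net n m w M (M j)| := by
  obtain ⟨h₁, h₂⟩ := lastIdx_spec hj
  rw [step, if_neg hj, net_elim h₁, net_orient]
  rwa [orient_of_lt h₁]

theorem net_le_net_step (j : ℕ) : net n m w M 0 ≤ net n m w (step n m w M j) 0 := by
  by_cases hj : lastIdx (M j) n = 0
  · rw [step, if_pos hj]
  · rw [net_step_of_ne hj]
    have := abs_nonneg (net n m w M (M j))
    omega

theorem exists_exc_step (j : ℕ) (z : ℕ → ZMod 2) :
    ∃ z', exc n m w M z' = exc n m w (step n m w M j) z := by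
  by_cases hj : lastIdx (M j) n = 0
  · exact ⟨z, by rw [step, if_pos hj]⟩
  · obtain ⟨h₁, h₂⟩ := lastIdx_spec hj
    rw [step, if_neg hj]
    exact exists_exc_elim h₁ (by rwa [orient_of_lt h₁]) z

/-- The number of equations with a nonzero left-hand side. -/
def rowsLeft (n m : ℕ) (M : ℕ → ℕ → ZMod 2) : ℕ :=
  ((Finset.range m).filter fun i => lastIdx (M i) n ≠ 0).card

/-- Zero rows have no pivot entry and stay zero, while row `j` cancels with itself. -/
theorem rowsLeft_step {j : ℕ} (hm : j < m) (hj : lastIdx (M j) n ≠ 0) :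
    rowsLeft n m (step n m w M j) < rowsLeft n m M := by
  obtain ⟨h₁, h₂⟩ := lastIdx_spec hj
  refine Finset.card_lt_card (Finset.ssubset_iff_of_subset (fun i hi => ?_) |>.2 ⟨j, ?_, ?_⟩)
  · simp only [Finset.mem_filter] at hi ⊢
    refine ⟨hi.1, fun h => hi.2 ?_⟩
    rw [lastIdx_eq_zero] at h ⊢
    intro c hc
    simp [step, hj, elim, h _ h₁, h c hc]
  · simp [hm, hj]
  · simp only [Finset.mem_filter, not_and, not_not]
    intro _
    rw [lastIdx_eq_zero]
    intro c hc
    simp [step, hj, elim, h₂, orient_of_lt hc, zmod2_add_self]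

theorem exc_of_rowsLeft_eq_zero (h : rowsLeft n m M = 0) (z : ℕ → ZMod 2) :
    exc n m w M z = net n m w M 0 := by
  refine Finset.sum_congr rfl fun i hi => ?_
  have h' : ∀ c < n, M i c = (0 : ℕ → ZMod 2) c := by
    rw [rowsLeft, Finset.card_eq_zero, Finset.filter_eq_empty_iff] at h
    simpa [lastIdx_eq_zero] using h hi
  rw [if_pos h', defect, Finset.sum_eq_zero, zero_add]
  · simp
  · intro c hc; rw [h' c (Finset.mem_range.1 hc), Pi.zero_apply, zero_mul]

/-- Some assignment reaches the total weight of the equations without variables. -/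
theorem exists_net_le_exc (M : ℕ → ℕ → ZMod 2) : ∃ z, net n m w M 0 ≤ exc n m w M z := by
  -- Eliminate with any nonzero row: the constant part does not drop, and the assignment found for
  -- the smaller system lifts back.
  induction hN : rowsLeft n m M using Nat.strong_induction_on generalizing M with
  | _ N ih =>
    by_cases h : N = 0
    · exact ⟨0, (exc_of_rowsLeft_eq_zero (hN.trans h) 0).ge⟩
    · obtain ⟨j, hj⟩ := Finset.card_pos.1 (Nat.pos_of_ne_zero (hN ▸ h))
      simp only [Finset.mem_filter, Finset.mem_range] at hj
      obtain ⟨z, hz⟩ := ih _ (hN ▸ rowsLeft_step (w := w) hj.1 hj.2) _ rfl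
      obtain ⟨z', hz'⟩ := exists_exc_step (n := n) (m := m) (w := w) (M := M) j z
      exact ⟨z', hz' ▸ (net_le_net_step j).trans hz⟩

/-- An assignment with an excess above the weight of the equations without variables satisfies an
equation with variables in its better version, of positive net weight. -/
theorem exists_orient_of_lt {z : ℕ → ZMod 2} (h : net n m w M 0 < exc n m w M z) :
    ∃ j < m, lastIdx (M j) n ≠ 0 ∧ 0 < |net n m w M (M j)| ∧
      defect n (orient n m w M (M j)) z = 0 := by
  by_contra! H
  refine h.not_ge ?_
  -- The nonconstant equations are grouped by left-hand side; each group contributes its net weight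
  -- times the sign of any one member.
  let key : ℕ → Fin n → ZMod 2 := fun i c => M i c
  have hkey : ∀ i j, key i = key j ↔ ∀ c < n, M i c = M j c := fun i j => by
    simp only [key, funext_iff, Fin.forall_iff]
  have hsplit : exc n m w M z = net n m w M 0 +
      ∑ i ∈ (Finset.range m).filter (fun i => lastIdx (M i) n ≠ 0),
        w i * sgn (defect n (M i) z) := by
    rw [exc, net, Finset.sum_filter, ← Finset.sum_add_distrib]
    refine Finset.sum_congr rfl fun i _ => ?_
    by_cases hi : ∀ c < n, M i c = (0 : ℕ → ZMod 2) c
    · rw [if_pos hi, if_neg (by simpa [lastIdx_eq_zero] using hi),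
        defect_of_eq (r' := 0) hi]
      simp [defect]
    · rw [if_neg hi, if_pos (by simpa [lastIdx_eq_zero] using hi), zero_add]
  rw [hsplit, ← Finset.sum_fiberwise_of_maps_to (t := Finset.image key
    ((Finset.range m).filter (fun i => lastIdx (M i) n ≠ 0))) fun i hi =>
      Finset.mem_image_of_mem key hi]
  suffices H' : ∀ j < m, lastIdx (M j) n ≠ 0 →
      ∑ i ∈ ((Finset.range m).filter (fun i => lastIdx (M i) n ≠ 0)).filter
        (fun i => key i = key j), w i * sgn (defect n (M i) z) ≤ 0 by
    have := Finset.sum_nonpos (s := Finset.image key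
      ((Finset.range m).filter (fun i => lastIdx (M i) n ≠ 0)))
      (f := fun b => ∑ i ∈ ((Finset.range m).filter (fun i => lastIdx (M i) n ≠ 0)).filter
        (fun i => key i = b), w i * sgn (defect n (M i) z)) fun b hb => by
      obtain ⟨j, hj, rfl⟩ := Finset.mem_image.1 hb
      simp only [Finset.mem_filter, Finset.mem_range] at hj
      exact H' j hj.1 hj.2
    omega
  intro j hj hj'
  have hsum : ∑ i ∈ ((Finset.range m).filter (fun i => lastIdx (M i) n ≠ 0)).filter
        (fun i => key i = key j), w i * sgn (defect n (M i) z) =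
      sgn (defect n (M j) z) * net n m w M (M j) := by
    rw [net, Finset.mul_sum, Finset.filter_filter, Finset.sum_filter]
    refine Finset.sum_congr rfl fun i _ => ?_
    by_cases hi : ∀ c < n, M i c = M j c
    · have : lastIdx (M i) n ≠ 0 := by
        rw [Ne, lastIdx_eq_zero] at hj' ⊢
        exact fun h' => hj' fun c hc => by rw [← hi c hc, h' c hc]
      rw [if_pos ⟨this, (hkey i j).2 hi⟩, if_pos hi, defect_of_eq hi, sgn_add]
      ring
    · rw [if_neg (fun h' => hi ((hkey i j).1 h'.2)), if_neg hi, mul_zero]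
  rw [hsum]
  rcases eq_or_ne (net n m w M (M j)) 0 with h0 | h0
  · simp [h0]
  have hd := H j hj hj' (abs_pos.2 h0)
  unfold orient at hd
  -- As `z` falsifies the oriented equation, the sign of row `j` at `z` is opposite to that of the
  -- net weight, so the product is not positive.
  split_ifs at hd with hneg
  · have : defect n (Function.update (M j) n (1 + M j n)) z = defect n (M j) z + 1 := by
      rw [defect_of_eq (r' := M j) fun c hc => Function.update_of_ne hc.ne _ _,
        Function.update_self, add_assoc, zmod2_add_self, add_zero]
    rw [this] at hd
    have : defect n (M j) z = 0 := by
      revert hd; generalize defect n (M j) z = a; revert a; decide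
    rw [this]
    simp only [sgn, if_true]; omega
  · simp only [sgn, if_neg hd]; omega

/-- Soundness of the search: an assignment reaching the constant part of the final system is lifted
back through all the steps. -/
theorem exists_le_exc_of_run {f : ℕ → ℕ} {k : ℤ} : ∀ {t : ℕ},
    k ≤ net n m w (run n m w M f t) 0 → ∃ z, k ≤ exc n m w M z := by
  suffices H : ∀ t z, ∃ z', exc n m w M z' = exc n m w (run n m w M f t) z by
    intro t h
    obtain ⟨z, hz⟩ := exists_net_le_exc (n := n) (m := m) (w := w) (run n m w M f t)
    obtain ⟨z', hz'⟩ := H t z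
    exact ⟨z', hz' ▸ h.trans hz⟩
  intro t
  induction t with
  | zero => exact fun z => ⟨z, rfl⟩
  | succ t ih =>
    intro z
    obtain ⟨z₁, h₁⟩ := exists_exc_step (n := n) (m := m) (w := w) (M := run n m w M f t) (f t) z
    obtain ⟨z₂, h₂⟩ := ih z₁
    exact ⟨z₂, h₂.trans h₁⟩

/-- `run` recurses on its last step, whereas the completeness induction chooses the first one. -/
theorem run_shift (f : ℕ → ℕ) (j t : ℕ) :
    run n m w M (fun s => if s = 0 then j else f (s - 1)) (t + 1) =
      run n m w (step n m w M j) f t := by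
  induction t with
  | zero => simp [run]
  | succ t ih => rw [run, ih]; simp [run]

theorem net_le_net_run (f : ℕ → ℕ) (t : ℕ) : net n m w M 0 ≤ net n m w (run n m w M f t) 0 := by
  induction t with
  | zero => exact le_rfl
  | succ t ih => exact ih.trans (net_le_net_step _)

/-- Completeness of the search. A step with an oriented equation satisfied by `z` keeps the excess
of `z`, raises the integer constant part by at least one and lowers the number of nonzero rows, so
either alternative of the hypothesis passes to `t` steps. -/
theorem exists_run_of_le_exc {k : ℤ} {z : ℕ → ZMod 2} : ∀ (t : ℕ) (M : ℕ → ℕ → ZMod 2),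
    (0 < t → 0 < m) → k ≤ exc n m w M z → k ≤ net n m w M 0 + t ∨ rowsLeft n m M ≤ t →
    ∃ f : ℕ → ℕ, (∀ s < t, f s < m) ∧ k ≤ net n m w (run n m w M f t) 0 := by
  intro t
  induction t with
  | zero =>
    intro M _ hz h
    refine ⟨0, by simp, ?_⟩
    rcases h with h | h
    · simpa [run] using h
    · rwa [exc_of_rowsLeft_eq_zero (Nat.le_zero.1 h)] at hz
  | succ t ih =>
    intro M hm hz h
    by_cases hk : k ≤ net n m w M 0
    -- The goal is already reached; equation `0` pads the sequence harmlessly, because no step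
    -- lowers the constant part.
    · exact ⟨0, fun _ _ => hm (Nat.succ_pos t), hk.trans (net_le_net_run _ _)⟩
    obtain ⟨j, hj, h₁, h₂, h₃⟩ := exists_orient_of_lt ((not_le.1 hk).trans_le hz)
    obtain ⟨f, hf, hf'⟩ := ih (step n m w M j) (fun _ => hm (Nat.succ_pos t))
      (by rwa [step, if_neg h₁, exc_elim h₃]) (by
        rcases h with h | h
        · left; rw [net_step_of_ne h₁]; push_cast at h; omega
        · right; have := rowsLeft_step (w := w) hj h₁; omega)
    refine ⟨fun s => if s = 0 then j else f (s - 1), fun s hs => ?_, by rwa [run_shift]⟩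
    dsimp only
    split_ifs with h0
    · exact hj
    · exact hf _ (by omega)

/-- It suffices to try the sequences of `min k m` equations. -/
theorem exists_le_exc_iff (hM : ∀ i < m, ∃ c < n, M i c ≠ 0) (k : ℕ) :
    (∃ z, (k : ℤ) ≤ exc n m w M z) ↔ ∃ f : ℕ → ℕ, (∀ s < min k m, f s < m) ∧
      (k : ℤ) ≤ net n m w (run n m w M f (min k m)) 0 := by
  refine ⟨fun ⟨z, hz⟩ => exists_run_of_le_exc _ M (by omega) hz ?_,
    fun ⟨f, _, hf⟩ => exists_le_exc_of_run hf⟩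
  have h0 : net n m w M 0 = 0 := Finset.sum_eq_zero fun i hi => if_neg fun h => by
    obtain ⟨c, hc, hc'⟩ := hM i (Finset.mem_range.1 hi)
    exact hc' (h c hc)
  have h1 : rowsLeft n m M ≤ m := (Finset.card_filter_le _ _).trans (Finset.card_range m).le
  rcases le_total k m with h | h
  · left; simp [h0, h]
  · right; simpa [h] using h1

end

/-! ### Systems as augmented matrices -/

/-- The augmented matrix of a system. -/
def System.aug {n m : ℕ} (S : System n m) (i c : ℕ) : ZMod 2 :=
  if hi : i < m then if hc : c < n then S.A ⟨i, hi⟩ ⟨c, hc⟩ else S.b ⟨i, hi⟩ else 0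

/-- The weights of a system, as a sequence. -/
def System.wt {n m : ℕ} (S : System n m) (i : ℕ) : ℕ := if hi : i < m then S.w ⟨i, hi⟩ else 0

theorem System.exc_aug {n m : ℕ} (S : System n m) (z : ℕ → ZMod 2) :
    exc n m S.wt S.aug z = S.excess fun c => z c := by
  rw [exc, excess, Finset.sum_range, Finset.sum_filter, Finset.sum_filter,
    ← Finset.sum_sub_distrib]
  refine Finset.sum_congr rfl fun i _ => ?_
  have h₁ : defect n (S.aug i) z = S.A.mulVec (fun c => z c) i + S.b i := by
    simp [defect, Finset.sum_range, aug, Matrix.mulVec, dotProduct]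
  have h₂ : ∀ a b : ZMod 2, a + b = 0 ↔ a = b := by decide
  rw [h₁, sgn]
  simp only [h₂, wt, i.isLt, dif_pos, Fin.eta]
  by_cases h : S.A.mulVec (fun c => z c) i = S.b i <;> simp [h]

/-- The finite criterion that the program checks. -/
theorem System.le_maxExcess_iff {n m : ℕ} (S : System n m) (k : ℕ) :
    (k : ℤ) ≤ S.maxExcess ↔ ∃ f : ℕ → ℕ, (∀ s < min k m, f s < m) ∧
      (k : ℤ) ≤ net n m S.wt (run n m S.wt S.aug f (min k m)) 0 := by
  rw [← exists_le_exc_iff, maxExcess, Finset.le_sup'_iff]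
  · constructor
    · rintro ⟨z, -, hz⟩
      refine ⟨fun c => if hc : c < n then z ⟨c, hc⟩ else 0, ?_⟩
      rw [exc_aug]
      simpa using hz
    · rintro ⟨z, hz⟩
      exact ⟨_, Finset.mem_univ _, S.exc_aug z ▸ hz⟩
  · intro i hi
    obtain ⟨c, hc⟩ := S.row_ne_zero ⟨i, hi⟩
    exact ⟨c, c.2, by simpa [aug, hi] using hc⟩

/-! ### The search program -/

infixr:30 " ;; " => Prog.seq

instance : Add Ex := ⟨Ex.add⟩
instance : Sub Ex := ⟨Ex.sub⟩

namespace Ex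

@[simp] theorem eval_add (σ : Store) (a b : Ex) : (a + b).eval σ = a.eval σ + b.eval σ := rfl
@[simp] theorem eval_sub (σ : Store) (a b : Ex) : (a - b).eval σ = a.eval σ - b.eval σ := rfl
@[simp] theorem eval_num (σ : Store) (c : ℕ) : (num c).eval σ = c := rfl
@[simp] theorem eval_var (σ : Store) (r : ℕ) : (var r).eval σ = σ.v r := rfl
@[simp] theorem eval_ld (σ : Store) (a : Ex) : (ld a).eval σ = σ.mem (a.eval σ) := rfl
@[simp] theorem eval_xor (σ : Store) (a b : Ex) : (xor a b).eval σ =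
    (a.eval σ - b.eval σ) + (b.eval σ - a.eval σ) := rfl
@[simp] theorem cost_add (a b : Ex) : (a + b).cost = a.cost + b.cost + 1 := rfl
@[simp] theorem cost_sub (a b : Ex) : (a - b).cost = a.cost + b.cost + 1 := rfl
@[simp] theorem cost_num (c : ℕ) : (num c).cost = 1 := rfl
@[simp] theorem cost_var (r : ℕ) : (var r).cost = 1 := rfl
@[simp] theorem cost_ld (a : Ex) : (ld a).cost = a.cost + 1 := rfl
@[simp] theorem cost_xor (a b : Ex) : (xor a b).cost = a.cost + b.cost + 1 + (b.cost + a.cost + 1) + 1 :=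
  rfl

end Ex

namespace Store

theorem Fr.refl (p : ℕ) (σ : Store) : σ.Fr p σ := fun _ _ => rfl

theorem Fr.trans {p q : ℕ} {σ τ ρ : Store} (h : σ.Fr p τ) (h' : τ.Fr q ρ) (hpq : p ≤ q) :
    σ.Fr p ρ := fun r hr => (h' r (hr.trans_le hpq)).trans (h r hr)

theorem Fr.mono {p q : ℕ} {σ τ : Store} (h : σ.Fr q τ) (hpq : p ≤ q) : σ.Fr p τ :=
  fun r hr => h r (hr.trans_le hpq)

@[simp] theorem fr_self (p : ℕ) (σ : Store) : σ.Fr p σ := Fr.refl p σ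

@[simp] theorem fr_set {p x a : ℕ} {σ τ : Store} (h : p ≤ x) : σ.Fr p (τ.set x a) ↔ σ.Fr p τ :=
  forall₂_congr fun r hr => by rw [set_v, Function.update_of_ne (by omega)]

@[simp] theorem fr_put {p x a : ℕ} {σ τ : Store} : σ.Fr p (τ.put x a) ↔ σ.Fr p τ := Iff.rfl

@[simp] theorem fr_tick {p t : ℕ} {σ τ : Store} : σ.Fr p (τ.tick t) ↔ σ.Fr p τ := Iff.rfl

@[simp] theorem set_fr {p x a : ℕ} {σ τ : Store} (h : p ≤ x) : (τ.set x a).Fr p σ ↔ τ.Fr p σ :=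
  forall₂_congr fun r hr => by rw [set_v, Function.update_of_ne (by omega)]

@[simp] theorem tick_fr {p t : ℕ} {σ τ : Store} : (τ.tick t).Fr p σ ↔ τ.Fr p σ := Iff.rfl

end Store

/-! ### Systems in memory and the program for one elimination step -/

open Ex Store

/-- Justifies `Ex.xor`: on bits, the two truncated differences add up to the sum modulo 2. -/
theorem val_add_eq (a b : ZMod 2) : (a + b).val = (a.val - b.val) + (b.val - a.val) := by
  revert a b; decide

/-- From address `W` on, the memory holds the augmented matrix `M` with the weights `w`. -/
def Rep (mem : ℕ → ℕ) (W n m : ℕ) (M : ℕ → ℕ → ZMod 2) (w : ℕ → ℕ) : Prop :=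
  ∀ i < m, (∀ c ≤ n, mem (W + i * (n + 2) + c) = (M i c).val) ∧
    mem (W + i * (n + 2) + (n + 1)) = w i

/-- From address `X` on, the memory holds the row `u`. -/
def Buf (mem : ℕ → ℕ) (X n : ℕ) (u : ℕ → ZMod 2) : Prop := ∀ c ≤ n, mem (X + c) = (u c).val

/-- The variables that describe the arrangement of the memory. -/
structure Layout (n m X W : ℕ) (σ : Store) : Prop where
  h2 : σ.v 2 = n
  h3 : σ.v 3 = m
  h6 : σ.v 6 = X
  h7 : σ.v 7 = W
  h9 : σ.v 9 = n + 2
  h11 : σ.v 11 = n + 1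

theorem Layout.of_fr {n m X W p : ℕ} {σ τ : Store} (h : Layout n m X W σ) (hf : σ.Fr p τ)
    (hp : 12 ≤ p) : Layout n m X W τ :=
  ⟨(hf 2 (by omega)).trans h.h2, (hf 3 (by omega)).trans h.h3, (hf 6 (by omega)).trans h.h6,
    (hf 7 (by omega)).trans h.h7, (hf 9 (by omega)).trans h.h9, (hf 11 (by omega)).trans h.h11⟩

/-- Variables 30 and 31 get the total weights of the equations that agree with the row in the buffer,
and of those that only have the same left-hand side. -/
def netProg : Prog :=
  asg 30 (num 0) ;; asg 31 (num 0) ;; asg 32 (var 7) ;; loop 33 3 (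
    asg 34 (num 0) ;;
    loop 35 2 (asg 34 (var 34 + xor (ld (var 32 + var 35)) (ld (var 6 + var 35)))) ;;
    ite (var 34) skip
      (ite (xor (ld (var 32 + var 2)) (ld (var 6 + var 2)))
        (asg 31 (var 31 + ld (var 32 + var 11))) (asg 30 (var 30 + ld (var 32 + var 11)))) ;;
    asg 32 (var 32 + var 9))

theorem wp_netProg {n m X W : ℕ} {M : ℕ → ℕ → ZMod 2} {w : ℕ → ℕ} {u : ℕ → ZMod 2} {σ : Store}
    (hL : Layout n m X W σ) (hM : Rep σ.mem W n m M w) (hu : Buf σ.mem X n u) :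
    wp netProg σ fun τ => σ.Fr 30 τ ∧ τ.mem = σ.mem ∧
      (τ.v 30 : ℤ) - τ.v 31 = net n m w M u ∧ τ.time ≤ σ.time + 100 * ((n + 1) * (m + 1)) := by
  refine wp_seq (wp_asg (wp_seq (wp_asg (wp_seq (wp_asg ?_)))))
  refine wp_loop 30 (n * 40 + 80) (fun i v mem => mem = σ.mem ∧ v 32 = W + i * (n + 2) ∧
    (v 30 : ℤ) - v 31 = net n i w M u) (by omega) (by omega) ?_ ?_ ?_
  · simp [hL.h7, net]
  · rintro i hi τ hτ hx ⟨hmem, hrow, hnet⟩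
    simp only [tick_fr, le_refl, set_fr, Nat.reduceLeDiff] at hτ
    simp [hL.h3] at hi
    have hL' := hL.of_fr hτ (by omega)
    refine wp_seq (wp_asg (wp_seq ?_))
    -- Variable 34 counts the columns in which row `i` and the buffer differ; only whether it is
    -- zero matters.
    refine wp_loop 34 22 (fun c v mem => mem = σ.mem ∧ (v 34 = 0 ↔ ∀ c' < c, M i c' = u c'))
      (by omega) (by omega) ?_ ?_ ?_
    · simp [hmem]
    · rintro c hc τ₁ hτ₁ hx₁ ⟨hmem₁, h34⟩
      simp [hL'.h2] at hc
      simp only [tick_fr, le_refl, set_fr] at hτ₁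
      refine wp_asg ?_
      have e₁ := (hM i hi).1 c hc.le
      have e₂ := hu c hc.le
      rw [Nat.forall_lt_succ_right, ← h34]
      simp [hx₁, hmem₁, hτ₁ 32, hτ₁ 6, hrow, hL'.h6, e₁, e₂, ← val_add_eq, CharTwo.add_eq_zero]
    · rintro τ₁ hτ₁ ⟨hmem₁, h34⟩ ht₁
      simp only [tick_fr, le_refl, set_fr] at hτ₁
      have hL₁ := hL'.of_fr hτ₁ (by omega)
      simp [hL'.h2] at ht₁ h34
      have e₁ := (hM i hi).1 n le_rfl
      have e₂ := hu n le_rfl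
      have e₃ := (hM i hi).2
      have hn : ∀ M : ℕ → ℕ → ZMod 2, net n (i + 1) w M u = net n i w M u +
          if ∀ c < n, M i c = u c then w i * sgn (M i n + u n) else 0 :=
        fun M => Finset.sum_range_succ _ _
      refine wp_seq (wp_ite ?_ ?_)
      · intro h
        refine wp_skip (wp_asg ?_)
        rw [eval_var, Nat.pos_iff_ne_zero, Ne, h34] at h
        simp [hτ₁ 30, hτ₁ 31, hτ₁ 32, hτ₁ 33, hmem₁, hL₁.h9, hrow, hn, if_neg h, hnet, hx, hτ₁.mono]
        exact ⟨by ring, by omega⟩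
      · intro h
        rw [eval_var, h34] at h
        refine wp_ite ?_ ?_
        · intro h'
          refine wp_asg (wp_asg ?_)
          simp only [eval_xor, eval_ld, eval_add, eval_var, tick_v, tick_mem, hτ₁ 32 (by omega),
            hmem₁, hL₁.h2, hL₁.h6, hrow, e₁, e₂, ← val_add_eq, Nat.pos_iff_ne_zero, Ne,
            ZMod.val_eq_zero] at h'
          simp [hτ₁ 30, hτ₁ 31, hτ₁ 32, hτ₁ 33, hmem₁, hL₁.h9, hL₁.h11, hrow, hn, if_pos h, ← hnet, hx, hτ₁.mono, e₃, sgn, h']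
          exact ⟨⟨by ring, by ring⟩, by omega⟩
        · intro h'
          refine wp_asg (wp_asg ?_)
          simp only [eval_xor, eval_ld, eval_add, eval_var, tick_v, tick_mem, hτ₁ 32 (by omega),
            hmem₁, hL₁.h2, hL₁.h6, hrow, e₁, e₂, ← val_add_eq, ZMod.val_eq_zero] at h'
          simp [hτ₁ 30, hτ₁ 31, hτ₁ 32, hτ₁ 33, hmem₁, hL₁.h9, hL₁.h11, hrow, hn, if_pos h, ← hnet, hx, hτ₁.mono, e₃, sgn, h']
          exact ⟨⟨by ring, by ring⟩, by omega⟩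
  · rintro τ hτ ⟨hmem, hrow, hnet⟩ ht
    simp [hL.h3] at hτ ht hnet
    refine ⟨hτ, hmem, hnet, ht.trans ?_⟩
    nlinarith

/-- The memory `mem`, with the cells `A, …, A + N - 1` overwritten by `f 0, …, f (N - 1)`. -/
def overw (mem : ℕ → ℕ) (A N : ℕ) (f : ℕ → ℕ) : ℕ → ℕ :=
  fun q => if A ≤ q ∧ q < A + N then f (q - A) else mem q

theorem overw_zero (mem : ℕ → ℕ) (A : ℕ) (f : ℕ → ℕ) : overw mem A 0 f = mem :=
  funext fun q => if_neg (by omega)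

theorem overw_lt {mem : ℕ → ℕ} {A N q : ℕ} {f : ℕ → ℕ} (h : q < A) : overw mem A N f q = mem q :=
  if_neg (by omega)

theorem overw_ge {mem : ℕ → ℕ} {A N q : ℕ} {f : ℕ → ℕ} (h : A + N ≤ q) :
    overw mem A N f q = mem q :=
  if_neg (by omega)

theorem overw_add {mem : ℕ → ℕ} {A N i : ℕ} {f : ℕ → ℕ} (h : i < N) :
    overw mem A N f (A + i) = f i := by
  rw [overw, if_pos (by omega), Nat.add_sub_cancel_left]

theorem update_overw (mem : ℕ → ℕ) (A i : ℕ) (f : ℕ → ℕ) :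
    Function.update (overw mem A i f) (A + i) (f i) = overw mem A (i + 1) f := by
  funext q
  by_cases hq : q = A + i
  · subst hq; rw [Function.update_self, overw_add (Nat.lt_succ_self i)]
  · rw [Function.update_of_ne hq]
    unfold overw
    exact if_congr (by omega) rfl rfl

/-- Serves copying, clearing and in-place row addition: `e` is evaluated in the memory whose first
`i` target cells are already overwritten, which is harmless as long as it reads other cells. -/
theorem wp_fill {x y a : ℕ} {e : Ex} {σ : Store} {Q : Store → Prop} (f : ℕ → ℕ)
    (hy : y < x) (ha : a < x)
    (he : ∀ i < σ.v y, ∀ τ, σ.Fr x τ → τ.v x = i → τ.mem = overw σ.mem (σ.v a) i f →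
      e.eval τ = f i)
    (hQ : ∀ τ, σ.Fr x τ → τ.mem = overw σ.mem (σ.v a) (σ.v y) f →
      τ.time ≤ σ.time + (σ.v y * (e.cost + 12) + 6) → Q τ) :
    wp (loop x y (sto (var a + var x) e)) σ Q := by
  refine wp_loop x (e.cost + 4) (fun i v mem => mem = overw σ.mem (σ.v a) i f) le_rfl hy
    (overw_zero _ _ _).symm ?_ hQ
  intro i hi τ hτ hx hmem
  refine wp_sto ?_
  simp only [eval_add, eval_var, cost_add, cost_var, fr_tick, fr_put, fr_self, tick_v, put_v, hx,
    tick_mem, put_mem, tick_time, put_time, hτ a ha, he i hi τ hτ hx hmem, true_and]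
  exact ⟨by rw [hmem, update_overw], by omega⟩

theorem row_disjoint {n i i' c : ℕ} (h : i ≠ i') (hc : c ≤ n + 1) :
    i' * (n + 2) + c < i * (n + 2) ∨ i * (n + 2) + (n + 2) ≤ i' * (n + 2) + c := by
  rcases Nat.lt_or_gt_of_ne h with h | h
  · right
    have := Nat.mul_le_mul_right (n + 2) h
    rw [Nat.succ_mul] at this; omega
  · left
    have := Nat.mul_le_mul_right (n + 2) h
    rw [Nat.succ_mul] at this; omega

theorem overw_row_ne {mem : ℕ → ℕ} {W n i i' c : ℕ} {f : ℕ → ℕ} (h : i ≠ i') (hc : c ≤ n + 1) :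
    overw mem (W + i * (n + 2)) (n + 1) f (W + i' * (n + 2) + c) =
      mem (W + i' * (n + 2) + c) := by
  rcases row_disjoint h hc with h | h
  · exact overw_lt (by omega)
  · exact overw_ge (by omega)

theorem Rep.congr {mem mem' : ℕ → ℕ} {W n m : ℕ} {M : ℕ → ℕ → ZMod 2} {w : ℕ → ℕ}
    (h : Rep mem W n m M w) (h' : ∀ a, W ≤ a → mem' a = mem a) : Rep mem' W n m M w :=
  fun i hi => ⟨fun c hc => by rw [h' _ (by omega), (h i hi).1 c hc],
    by rw [h' _ (by omega), (h i hi).2]⟩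

theorem Buf.congr {mem mem' : ℕ → ℕ} {X n : ℕ} {u : ℕ → ZMod 2}
    (h : Buf mem X n u) (h' : ∀ a, X ≤ a → a < X + n + 1 → mem' a = mem a) : Buf mem' X n u :=
  fun c hc => by rw [h' _ (by omega) (by omega), h c hc]

/-- Copies the row whose number is in variable 20 to the buffer. -/
def loadRow : Prog :=
  asg 21 (var 7) ;; loop 22 20 (asg 21 (var 21 + var 9)) ;;
    loop 22 11 (sto (var 6 + var 22) (ld (var 21 + var 22)))

theorem wp_loadRow {n m X j : ℕ} {M : ℕ → ℕ → ZMod 2} {w : ℕ → ℕ} {σ : Store}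
    (hL : Layout n m X (X + n + 1) σ) (hM : Rep σ.mem (X + n + 1) n m M w) (hj : σ.v 20 = j)
    (hjm : j < m) :
    wp loadRow σ fun τ => σ.Fr 21 τ ∧ (∀ a < X, τ.mem a = σ.mem a) ∧
      Rep τ.mem (X + n + 1) n m M w ∧ Buf τ.mem X n (M j) ∧
      τ.time ≤ σ.time + 60 * ((n + 1) * (m + 1)) := by
  refine wp_seq (wp_asg (wp_seq ?_))
  -- The machine cannot multiply, so the row address is found by repeated addition of the row
  -- length.
  refine wp_loop 21 4 (fun i v mem => mem = σ.mem ∧ v 21 = X + n + 1 + i * (n + 2))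
    (by omega) (by omega) ?_ ?_ ?_
  · simp [hL.h7]
  · rintro i hi τ hτ hx ⟨hmem, h21⟩
    simp only [tick_fr, le_refl, set_fr] at hτ
    refine wp_asg ?_
    simp [hτ 9, hL.h9, hx, hmem, h21]
    ring
  · rintro τ hτ ⟨hmem, h21⟩ ht
    simp [hj] at hτ ht h21
    refine wp_fill (fun c => σ.mem (X + n + 1 + j * (n + 2) + c)) (by omega) (by omega) ?_ ?_
    · intro c hc τ₁ hτ₁ hx hmem₁
      simp only [eval_ld, eval_add, eval_var, hx, hτ₁ 21 (by omega), hmem₁, h21, hτ 6 (by omega),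
        hL.h6]
      rw [hτ 11 (by omega), hL.h11] at hc
      rw [overw_ge (by omega), hmem]
    · intro τ₁ hτ₁ hmem₁ ht₁
      rw [hτ 6 (by omega), hL.h6, hτ 11 (by omega), hL.h11, hmem] at hmem₁
      rw [hτ 11 (by omega), hL.h11] at ht₁
      refine ⟨hτ.trans hτ₁ (by omega), fun a ha => ?_, hM.congr fun a ha => ?_, fun c hc => ?_, ?_⟩
      · rw [hmem₁, overw_lt ha]
      · rw [hmem₁, overw_ge (by omega)]
      · rw [hmem₁, overw_add (by omega), (hM j hjm).1 c hc]
      · simp at ht₁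
        nlinarith

/-- Variable 23 gets one more than the index of the last nonzero coefficient in the buffer. -/
def findPivot : Prog :=
  asg 23 (num 0) ;; loop 24 2 (ite (ld (var 6 + var 24)) (asg 23 (var 24 + num 1)) skip)

theorem wp_findPivot {n m X W : ℕ} {u : ℕ → ZMod 2} {σ : Store}
    (hL : Layout n m X W σ) (hu : Buf σ.mem X n u) :
    wp findPivot σ fun τ => σ.Fr 23 τ ∧ τ.mem = σ.mem ∧ τ.v 23 = lastIdx u n ∧
      τ.time ≤ σ.time + 20 * (n + 1) := by
  refine wp_seq (wp_asg ?_)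
  refine wp_loop 23 10 (fun i v mem => mem = σ.mem ∧ v 23 = lastIdx u i)
    (by omega) (by omega) ?_ ?_ ?_
  · simp [lastIdx]
  · rintro i hi τ hτ hx ⟨hmem, h23⟩
    simp only [tick_fr, le_refl, set_fr] at hτ
    simp [hL.h2] at hi
    have e := hu i hi.le
    refine wp_ite (fun h => wp_asg ?_) (fun h => wp_skip ?_)
    · simp only [eval_ld, eval_add, eval_var, hx, hmem, hτ 6 (by omega), hL.h6, e,
        Nat.pos_iff_ne_zero, Ne, ZMod.val_eq_zero] at h
      simp [hx, hmem, lastIdx, h]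
    · simp only [eval_ld, eval_add, eval_var, hx, hmem, hτ 6 (by omega), hL.h6, e,
        ZMod.val_eq_zero] at h
      simp [hx, hmem, lastIdx, h, h23]
  · rintro τ hτ ⟨hmem, h23⟩ ht
    simp [hL.h2] at hτ ht h23
    exact ⟨hτ, hmem, h23, by omega⟩

/-- Adds the row in the buffer to all rows with a nonzero entry in the column given by variable 23
(minus one). -/
def elimProg : Prog :=
  asg 25 (var 7) ;; loop 26 3 (
    ite (ld (var 25 + var 23 - num 1))
      (loop 27 11 (sto (var 25 + var 27) (xor (ld (var 25 + var 27)) (ld (var 6 + var 27)))))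
      skip ;;
    asg 25 (var 25 + var 9))

theorem wp_elimProg {n m X p : ℕ} {M : ℕ → ℕ → ZMod 2} {w : ℕ → ℕ} {u : ℕ → ZMod 2} {σ : Store}
    (hL : Layout n m X (X + n + 1) σ) (hM : Rep σ.mem (X + n + 1) n m M w)
    (hu : Buf σ.mem X n u) (hp : σ.v 23 = p + 1) (hpn : p < n) :
    wp elimProg σ fun τ => σ.Fr 25 τ ∧ (∀ a < X, τ.mem a = σ.mem a) ∧
      Rep τ.mem (X + n + 1) n m (elim M u p) w ∧
      τ.time ≤ σ.time + 120 * ((n + 1) * (m + 1)) := by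
  refine wp_seq (wp_asg ?_)
  -- The rows before `i` are already eliminated, the others still original; the buffer lies below
  -- the matrix and is preserved.
  refine wp_loop 25 (n * 40 + 90) (fun i v mem => v 25 = X + n + 1 + i * (n + 2) ∧
    (∀ a < X + n + 1, mem a = σ.mem a) ∧
    Rep mem (X + n + 1) n m (fun i' => if i' < i then elim M u p i' else M i') w)
    (by omega) (by omega) ?_ ?_ ?_
  · simpa [hL.h7] using hM
  · rintro i hi τ hτ hx ⟨h25, hlow, hrep⟩
    simp only [tick_fr, le_refl, set_fr] at hτ
    simp [hL.h3] at hi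
    have hu' : Buf τ.mem X n u := hu.congr fun a _ ha => hlow a ha
    have hrow : ∀ c ≤ n, τ.mem (X + n + 1 + i * (n + 2) + c) = (M i c).val := fun c hc => by
      simpa using (hrep i hi).1 c hc
    have hval : (ld (var 25 + var 23 - num 1)).eval τ = (M i p).val := by
      rw [← hrow p hpn.le, ← h25]
      simp [hτ 23, hp]
    have hrest : ∀ i' < m, i' ≠ i → (if i' < i + 1 then elim M u p i' else M i') =
        if i' < i then elim M u p i' else M i' := fun i' _ h => if_congr (by omega) rfl rfl
    refine wp_seq (wp_ite ?_ ?_)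
    · intro h
      rw [hval, Nat.pos_iff_ne_zero, Ne, ZMod.val_eq_zero] at h
      -- Only `n + 1` cells are written, so the default `0` never occurs and the weight in the last
      -- cell of the row survives.
      refine wp_fill (fun c => if c ≤ n then (M i c + u c).val else 0) (by omega) (by omega) ?_ ?_
      · intro c hc τ₁ hτ₁ hx₁ hmem₁
        simp only [tick_v, tick_mem] at hc hmem₁
        simp only [tick_fr] at hτ₁
        rw [hτ 11 (by omega), hL.h11] at hc
        rw [h25] at hmem₁
        simp only [eval_xor, eval_ld, eval_add, eval_var, hx₁, hτ₁ 25 (by omega),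
          hτ₁ 6 (by omega), h25, hτ 6 (by omega), hL.h6, hmem₁]
        rw [overw_ge le_rfl, overw_lt (by omega), hrow c (by omega), hu' c (by omega), ← val_add_eq,
          if_pos (by omega)]
      · intro τ₁ hτ₁ hmem₁ ht₁
        simp only [tick_v, tick_mem, tick_fr] at hτ₁ hmem₁
        rw [h25, hτ 11 (by omega), hL.h11] at hmem₁
        simp [hτ 11, hL.h11] at ht₁
        refine wp_asg ?_
        refine ⟨by simp [hτ₁.mono], by simp [hτ₁ 26, hx], ⟨?_, fun a ha => ?_, fun i' hi' => ?_⟩, ?_⟩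
        · simp [hτ₁ 25, hτ₁ 9, hτ 9, h25, hL.h9]; ring
        · simp only [tick_mem, set_mem]
          rw [hmem₁, overw_lt (by omega), hlow a ha]
        swap
        · simp; omega
        simp only [tick_mem, set_mem, hmem₁]
        rcases eq_or_ne i' i with rfl | hne
        · refine ⟨fun c hc => ?_, ?_⟩
          · rw [overw_add (by omega), if_pos hc, if_pos (Nat.lt_succ_self _), elim, if_neg h]
          · rw [overw_ge (by omega), (hrep _ hi).2]
        · rw [hrest i' hi' hne, overw_row_ne hne.symm le_rfl]
          refine ⟨fun c hc => ?_, (hrep _ hi').2⟩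
          rw [overw_row_ne hne.symm (by omega), (hrep _ hi').1 c hc]
    · intro h
      rw [hval, ZMod.val_eq_zero] at h
      refine wp_skip (wp_asg ?_)
      refine ⟨by simp, by simp [hx], ⟨?_, hlow, fun i' hi' => ?_⟩, ?_⟩
      · simp [hτ 9, h25, hL.h9]; ring
      swap
      · simp; omega
      simp only [tick_mem, set_mem]
      rcases eq_or_ne i' i with rfl | hne
      · refine ⟨fun c hc => ?_, (hrep _ hi').2⟩
        rw [hrow c hc, if_pos (Nat.lt_succ_self _), elim, if_pos h]
      · rw [hrest i' hi' hne]; exact hrep i' hi'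
  · rintro τ hτ ⟨h25, hlow, hrep⟩ ht
    simp [hL.h3] at hτ ht hrep
    refine ⟨hτ, fun a ha => hlow a (by omega), fun i hi => ?_, by nlinarith⟩
    simpa only [if_pos hi] using hrep i hi

/-- Substitutes the equation whose number is in variable 20. -/
def stepProg : Prog :=
  loadRow ;; findPivot ;; ite (var 23)
    (netProg ;;
      ite (var 31 - var 30) (sto (var 6 + var 2) (num 1 - ld (var 6 + var 2))) skip ;;
      elimProg)
    skip

theorem val_one_add (a : ZMod 2) : (1 + a).val = 1 - a.val := by
  revert a; decide

theorem wp_stepProg {n m X j : ℕ} {M : ℕ → ℕ → ZMod 2} {w : ℕ → ℕ} {σ : Store}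
    (hL : Layout n m X (X + n + 1) σ) (hM : Rep σ.mem (X + n + 1) n m M w) (hj : σ.v 20 = j)
    (hjm : j < m) :
    wp stepProg σ fun τ => σ.Fr 21 τ ∧ (∀ a < X, τ.mem a = σ.mem a) ∧
      Rep τ.mem (X + n + 1) n m (step n m w M j) w ∧
      τ.time ≤ σ.time + 400 * ((n + 1) * (m + 1)) := by
  have hpos : n + 1 ≤ (n + 1) * (m + 1) := Nat.le_mul_of_pos_right _ (Nat.succ_pos m)
  refine wp_seq ((wp_loadRow hL hM hj hjm).mono ?_)
  rintro τ₁ ⟨f₁, low₁, rep₁, buf₁, t₁⟩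
  have hL₁ := hL.of_fr f₁ (by omega)
  refine wp_seq ((wp_findPivot hL₁ buf₁).mono ?_)
  rintro τ₂ ⟨f₂, mem₂, piv, t₂⟩
  have hL₂ := hL₁.of_fr f₂ (by omega)
  have f₂' := f₁.trans f₂ (by omega)
  rw [← mem₂] at low₁ rep₁ buf₁
  refine wp_ite ?_ ?_
  · intro h
    rw [eval_var, piv, Nat.pos_iff_ne_zero] at h
    obtain ⟨p₁, p₂⟩ := lastIdx_spec h
    refine wp_seq ((wp_netProg (σ := τ₂.tick _) (hL₂.of_fr (Fr.refl 12 _) le_rfl) rep₁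
      buf₁).mono ?_)
    rintro τ₃ ⟨f₃, mem₃, net₃, t₃⟩
    rw [tick_fr] at f₃
    have hL₃ := hL₂.of_fr f₃ (by omega)
    simp only [tick_mem] at mem₃
    rw [← mem₃] at low₁ rep₁ buf₁
    have f₃' := f₂'.trans f₃ (by omega)
    have hu : wp (ite (var 31 - var 30) (sto (var 6 + var 2) (num 1 - ld (var 6 + var 2))) skip)
        τ₃ fun τ => τ₃.Fr 30 τ ∧ (∀ a < X, τ.mem a = σ.mem a) ∧
          Rep τ.mem (X + n + 1) n m M w ∧ Buf τ.mem X n (orient n m w M (M j)) ∧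
          τ.time ≤ τ₃.time + 20 := by
      refine wp_ite ?_ ?_
      · intro h'
        simp only [eval_sub, eval_var] at h'
        refine wp_sto ?_
        simp only [tick_fr, fr_tick, fr_put, fr_self, tick_mem, put_mem, eval_add, eval_sub,
          eval_num, eval_ld, eval_var, tick_v, hL₃.h6, hL₃.h2, tick_time, put_time, cost_sub,
          cost_add, cost_num, cost_ld, cost_var, true_and]
        refine ⟨fun a ha => ?_, rep₁.congr fun a ha => ?_, fun c hc => ?_, by omega⟩
        · rw [Function.update_of_ne (by omega), low₁ a ha]
        · rw [Function.update_of_ne (by omega)]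
        -- Variables 30 and 31 hold the two parts of the net weight, so `31 - 30` is positive
        -- exactly when the net weight is negative.
        · rw [orient, if_pos (by omega)]
          rcases hc.lt_or_eq with hc | rfl
          · rw [Function.update_of_ne (by omega), Function.update_of_ne (by omega), buf₁ c hc.le]
          · rw [Function.update_self, Function.update_self, val_one_add, buf₁ c le_rfl]
      · intro h'
        simp only [eval_sub, eval_var] at h'
        refine wp_skip ?_
        rw [orient, if_neg (by omega)]
        simpa using ⟨low₁, rep₁, buf₁⟩
    refine wp_seq (hu.mono ?_)
    rintro τ₄ ⟨f₄, low₄, rep₄, buf₄, t₄⟩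
    refine (wp_elimProg (hL₃.of_fr f₄ (by omega)) rep₄ buf₄
      (p := lastIdx (M j) n - 1) ?_ p₁).mono ?_
    · rw [f₄ 23 (by omega), f₃ 23 (by omega), piv]; omega
    · rintro τ₅ ⟨f₅, low₅, rep₅, t₅⟩
      refine ⟨(f₃'.trans f₄ (by omega)).trans f₅ (by omega),
        fun a ha => by rw [low₅ a ha, low₄ a ha], ?_, ?_⟩
      · rwa [step, if_neg h]
      · simp at t₃; nlinarith
  · intro h
    rw [eval_var, piv] at h
    refine wp_skip ?_
    rw [step, if_pos h]
    refine ⟨by simpa using f₂', low₁, rep₁, ?_⟩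
    simp; nlinarith

/-- Complements `Rep.congr`: the search writes only behind the original data, which therefore stay
valid. -/
theorem Rep.congr_lt {mem mem' : ℕ → ℕ} {W n m : ℕ} {M : ℕ → ℕ → ZMod 2} {w : ℕ → ℕ}
    (h : Rep mem W n m M w) (h' : ∀ a < W + m * (n + 2), mem' a = mem a) :
    Rep mem' W n m M w := fun i hi => by
  have := Nat.mul_le_mul_right (n + 2) hi
  rw [Nat.succ_mul] at this
  exact ⟨fun c hc => by rw [h' _ (by omega), (h i hi).1 c hc],
    by rw [h' _ (by omega), (h i hi).2]⟩

/-! ### Trying all sequences of equations -/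

/-- The variables of the search: the parameter `k`, and the addresses of the data and of the
sequence of equations to be tried. -/
structure Search (n m k D G : ℕ) (σ : Store) : Prop
    extends Layout n m (G + min k m) (G + min k m + n + 1) σ where
  h1 : σ.v 1 = k
  h4 : σ.v 4 = D
  h5 : σ.v 5 = G
  h8 : σ.v 8 = min k m
  h10 : σ.v 10 = m * (n + 2)
  hG : D + m * (n + 2) ≤ G

theorem Search.of_fr {n m k D G p : ℕ} {σ τ : Store} (h : Search n m k D G σ) (hf : σ.Fr p τ)
    (hp : 12 ≤ p) : Search n m k D G τ :=
  { h.toLayout.of_fr hf hp with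
    h1 := (hf 1 (by omega)).trans h.h1
    h4 := (hf 4 (by omega)).trans h.h4
    h5 := (hf 5 (by omega)).trans h.h5
    h8 := (hf 8 (by omega)).trans h.h8
    h10 := (hf 10 (by omega)).trans h.h10
    hG := h.hG }

/-- Tries one sequence of equations; variable 18 becomes positive if it proves a large excess. -/
def tupleProg : Prog :=
  loop 20 10 (sto (var 7 + var 20) (ld (var 4 + var 20))) ;;
  loop 19 8 (asg 20 (ld (var 5 + var 19)) ;; stepProg) ;;
  loop 20 11 (sto (var 6 + var 20) (num 0)) ;;
  netProg ;;
  ite (var 31 + var 1 - var 30) skip (asg 18 (num 1))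

/-- The steps act on a fresh copy of the system. Afterwards the buffer is cleared, so that `netProg`
computes the weight of the constant rows. -/
theorem wp_tupleProg {n m k D G : ℕ} {M : ℕ → ℕ → ZMod 2} {w f : ℕ → ℕ} {σ : Store}
    (hS : Search n m k D G σ) (hM : Rep σ.mem D n m M w)
    (hf : ∀ t < min k m, σ.mem (G + t) = f t) (hfm : ∀ t < min k m, f t < m) :
    wp tupleProg σ fun τ => σ.Fr 18 τ ∧ (∀ a < G + min k m, τ.mem a = σ.mem a) ∧
      (0 < τ.v 18 ↔ 0 < σ.v 18 ∨ (k : ℤ) ≤ net n m w (run n m w M f (min k m)) 0) ∧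
      τ.time ≤ σ.time + 1000 * ((m + 1) * ((n + 1) * (m + 1))) := by
  have hG := hS.hG
  refine wp_seq (wp_fill (fun a => σ.mem (D + a)) (by omega) (by omega) ?_ ?_)
  · intro a ha τ hτ hx hmem
    rw [hS.h10] at ha
    rw [hS.h7] at hmem
    simp only [eval_ld, eval_add, eval_var, hx, hτ 4 (by omega), hS.h4, hmem]
    rw [overw_lt (by omega)]
  intro τ₁ f₁ mem₁ t₁
  rw [hS.h7, hS.h10] at mem₁
  have hS₁ := hS.of_fr f₁ (by omega)
  have low₁ : ∀ a < G + min k m, τ₁.mem a = σ.mem a := fun a ha => by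
    rw [mem₁, overw_lt (by omega)]
  have rep₁ : Rep τ₁.mem (G + min k m + n + 1) n m M w := fun i hi => by
    have := Nat.mul_le_mul_right (n + 2) hi
    rw [Nat.succ_mul] at this
    rw [mem₁]
    refine ⟨fun c hc => ?_, ?_⟩
    · rw [Nat.add_assoc _ (i * (n + 2)), overw_add (by omega), ← Nat.add_assoc, (hM i hi).1 c hc]
    · rw [Nat.add_assoc _ (i * (n + 2)), overw_add (by omega), ← Nat.add_assoc, (hM i hi).2]
  refine wp_seq (wp_loop 19 (400 * ((n + 1) * (m + 1)) + 5) (fun t v mem =>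
    (∀ a < G + min k m, mem a = σ.mem a) ∧
      Rep mem (G + min k m + n + 1) n m (run n m w M f t) w) le_rfl (by omega)
      ⟨low₁, rep₁⟩ ?_ ?_)
  · rintro t ht τ hτ hx ⟨low, rep⟩
    rw [hS₁.h8] at ht
    have hSτ := hS₁.of_fr hτ (by omega)
    refine wp_seq (wp_asg ?_)
    refine (wp_stepProg (j := f t) (X := G + min k m) (n := n) (M := run n m w M f t)
      (w := w) ?_ ?_ ?_ (hfm t ht)).mono ?_
    · exact hSτ.toLayout.of_fr (p := 20) (by simp) (by omega)
    · exact rep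
    · simp [hSτ.h5, hx, low _ (Nat.add_lt_add_left ht G), hf t ht]
    · rintro τ' ⟨f', low', rep', t'⟩
      simp at t'
      have f'' : τ.Fr 20 τ' := by simpa using f'.mono (p := 20) (by omega)
      refine ⟨f''.mono (by omega), ?_, ⟨fun a ha => ?_, rep'⟩, ?_⟩
      swap
      · rw [low' a ha]; exact low a ha
      swap
      · exact t'.trans (by rw [Nat.add_assoc, Nat.add_comm 5])
      · rw [f' 19 (by omega)]; simp [hx]
  · rintro τ₂ f₂ ⟨low₂, rep₂⟩ t₂
    have hS₂ := hS₁.of_fr f₂ (by omega)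
    rw [hS₁.h8] at rep₂
    refine wp_seq (wp_fill (fun _ => 0) (by omega) (by omega) (fun _ _ _ _ _ _ => rfl) ?_)
    intro τ₃ f₃ mem₃ t₃
    have hS₃ := hS₂.of_fr f₃ (by omega)
    rw [hS₂.h6, hS₂.h11] at mem₃
    refine wp_seq ((wp_netProg (u := 0) hS₃.toLayout
      (rep₂.congr fun a ha => ?_) fun c hc => ?_).mono ?_)
    · rw [mem₃, overw_ge (by omega)]
    · rw [mem₃, overw_add (by omega)]; rfl
    rintro τ₄ ⟨f₄, mem₄, net₄, t₄⟩
    have f₄' : σ.Fr 19 τ₄ := ((f₁.mono (by omega)).trans f₂ le_rfl).trans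
      (f₃.trans f₄ (by omega)) (by omega)
    have low₄ : ∀ a < G + min k m, τ₄.mem a = σ.mem a := fun a ha => by
      rw [mem₄, mem₃, overw_lt ha, low₂ a ha]
    have time₄ : τ₄.time + 20 ≤ σ.time + 1000 * ((m + 1) * ((n + 1) * (m + 1))) := by
      simp only [hS.h10, hS₁.h8, hS₂.h11, cost_ld, cost_add, cost_var, cost_num] at t₁ t₂ t₃
      -- Bounding the number of steps by `m` rather than `k` keeps the cost of one sequence
      -- independent of `k`.
      have h₁ : min k m * (400 * ((n + 1) * (m + 1)) + 5 + 8) ≤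
          m * (400 * ((n + 1) * (m + 1)) + 13) := Nat.mul_le_mul_right _ (min_le_right _ _)
      have h₂ : τ₄.time ≤ σ.time + (m * (n + 2) * 16 + 6) +
        (m * (400 * ((n + 1) * (m + 1)) + 13) + 6) + ((n + 1) * 13 + 6) +
        100 * ((n + 1) * (m + 1)) := by omega
      refine (Nat.add_le_add_right h₂ 20).trans ?_
      have h₃ : 1 ≤ (n + 1) * (m + 1) := Nat.mul_pos n.succ_pos m.succ_pos
      have h₄ : m * (n + 2) ≤ 2 * ((n + 1) * (m + 1)) := by nlinarith
      have h₅ : n + 1 ≤ (n + 1) * (m + 1) := Nat.le_mul_of_pos_right _ m.succ_pos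
      have h₆ : m * 1 ≤ m * ((n + 1) * (m + 1)) := Nat.mul_le_mul_left m h₃
      have e₁ : m * (400 * ((n + 1) * (m + 1)) + 13) =
        400 * (m * ((n + 1) * (m + 1))) + 13 * m := by ring
      have e₂ : (m + 1) * ((n + 1) * (m + 1)) =
        m * ((n + 1) * (m + 1)) + (n + 1) * (m + 1) := by ring
      rw [e₁, e₂]
      omega
    have h1 := f₄' 1 (by omega)
    have h18 := f₄' 18 (by omega)
    refine wp_ite (fun h => wp_skip ?_) fun h => wp_asg ?_
    · simp only [eval_sub, eval_add, eval_var, h1, hS.h1] at h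
      refine ⟨f₄'.mono (by omega), low₄, ?_, by simp; omega⟩
      simp only [tick_v, h18]
      -- The truncated difference `31 + k - 30` is positive exactly when the net weight is less than
      -- `k`.
      have : ¬ (k : ℤ) ≤ net n m w (run n m w M f (min k m)) 0 := by omega
      simp [this]
    · simp only [eval_sub, eval_add, eval_var, h1, hS.h1] at h
      refine ⟨by simpa using f₄'.mono (by omega), low₄, ?_, by simp; omega⟩
      have : (k : ℤ) ≤ net n m w (run n m w M f (min k m)) 0 := by omega
      simp [this]

/-- Adds one to the number whose digits to the base `m` are stored; variable 20 gets the carry. -/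
def nextProg : Prog :=
  asg 20 (num 1) ;; loop 21 8 (ite (var 20)
    (asg 22 (ld (var 5 + var 21) + num 1) ;;
      ite (var 3 - var 22) (sto (var 5 + var 21) (var 22) ;; asg 20 (num 0))
        (sto (var 5 + var 21) (num 0)))
    skip)

theorem digit_succ_of_not_dvd {N m t : ℕ} (h : ¬ m ^ t ∣ N + 1) :
    (N + 1) / m ^ t % m = N / m ^ t % m := by
  rw [Nat.succ_div_of_not_dvd h]

/-- Divisibility of `N + 1` by `m ^ t` says that a carry arrives at digit `t`; it is passed on
exactly if that digit is `m - 1`. -/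
theorem digit_succ_of_dvd {N m t : ℕ} (hm : 0 < m) (h : m ^ t ∣ N + 1) :
    (N + 1) / m ^ t % m = (if N / m ^ t % m + 1 < m then N / m ^ t % m + 1 else 0) ∧
      (m ^ (t + 1) ∣ N + 1 ↔ ¬ N / m ^ t % m + 1 < m) := by
  have h₁ : (N + 1) / m ^ t = N / m ^ t + 1 := Nat.succ_div_of_dvd h
  have h₂ : m ^ (t + 1) ∣ N + 1 ↔ m ∣ N / m ^ t + 1 := by
    rw [← h₁, pow_succ, Nat.dvd_div_iff_mul_dvd h]
  rw [h₂, h₁, Nat.dvd_iff_mod_eq_zero, Nat.add_mod]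
  have h₃ := Nat.mod_lt (N / m ^ t) hm
  rcases Nat.lt_or_ge 1 m with hm₁ | hm₁
  · rw [Nat.mod_eq_of_lt hm₁]
    split_ifs with h
    · rw [Nat.mod_eq_of_lt h]; simp [h]
    · rw [show N / m ^ t % m + 1 = m by omega]; simp
  · obtain rfl : m = 1 := by omega
    simp [Nat.mod_one]

theorem wp_nextProg {n m k D G N : ℕ} {σ : Store} (hS : Search n m k D G σ)
    (hN : ∀ t < min k m, σ.mem (G + t) = N / m ^ t % m) :
    wp nextProg σ fun τ => σ.Fr 20 τ ∧ (∀ a < G, τ.mem a = σ.mem a) ∧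
      (∀ t < min k m, τ.mem (G + t) = (N + 1) / m ^ t % m) ∧
      τ.v 20 = (if m ^ min k m ∣ N + 1 then 1 else 0) ∧
      τ.time ≤ σ.time + 60 * (m + 1) := by
  refine wp_seq (wp_asg ?_)
  -- The digits before `t` are those of `N + 1`, the others those of `N`, and variable 20 is the
  -- carry into digit `t`.
  refine wp_loop 20 40 (fun t v mem => (∀ a < G, mem a = σ.mem a) ∧
    (∀ t' < min k m, mem (G + t') = if t' < t then (N + 1) / m ^ t' % m else N / m ^ t' % m) ∧
      v 20 = if m ^ t ∣ N + 1 then 1 else 0) (by omega) (by omega) ?_ ?_ ?_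
  · simpa using hN
  · rintro t ht τ hτ hx ⟨low, dig, h20⟩
    simp only [tick_fr, le_refl, set_fr] at hτ
    have ht : t < min k m := by simpa [hS.h8] using ht
    have hm : 0 < m := by omega
    have hSτ := hS.of_fr hτ (by omega)
    have hdig := dig t ht
    rw [if_neg (lt_irrefl t)] at hdig
    have key : ∀ mem' : ℕ → ℕ, mem' (G + t) = (N + 1) / m ^ t % m →
        (∀ a, a ≠ G + t → mem' a = τ.mem a) → (∀ a < G, mem' a = σ.mem a) ∧
        ∀ t' < min k m, mem' (G + t') =
          if t' < t + 1 then (N + 1) / m ^ t' % m else N / m ^ t' % m := by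
      intro mem' h₁ h₂
      refine ⟨fun a ha => by rw [h₂ a (by omega), low a ha], fun t' ht' => ?_⟩
      rcases eq_or_ne t' t with rfl | hne
      · rw [h₁, if_pos (Nat.lt_succ_self _)]
      · rw [h₂ _ (by omega), dig t' ht']
        exact if_congr (by omega) rfl rfl
    refine wp_ite ?_ ?_
    · intro h
      have hd : m ^ t ∣ N + 1 := by
        by_contra hd
        simp [h20, hd] at h
      obtain ⟨d₁, d₂⟩ := digit_succ_of_dvd hm hd
      refine wp_seq (wp_asg (wp_ite ?_ ?_))
      · intro h'
        have h' : N / m ^ t % m + 1 < m := by simpa [hSτ.h3, hSτ.h5, hx, hdig] using h'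
        rw [if_pos h'] at d₁
        refine wp_seq (wp_sto (wp_asg ?_))
        obtain ⟨k₁, k₂⟩ := key (Function.update τ.mem (G + t) (N / m ^ t % m + 1))
          (by rw [Function.update_self, d₁]) (fun a ha => Function.update_of_ne ha _ _)
        refine ⟨by simp, by simp [hx], ⟨?_, ?_, ?_⟩, ?_⟩
        · simpa [hSτ.h5, hx, hdig] using k₁
        · simpa [hSτ.h5, hx, hdig] using k₂
        · simp [d₂, h']
        · simp
      · intro h'
        have h' : ¬ N / m ^ t % m + 1 < m := by
          have : m ≤ N / m ^ t % m + 1 := by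
            simpa [hSτ.h3, hSτ.h5, hx, hdig, Nat.sub_eq_zero_iff_le] using h'
          omega
        rw [if_neg h'] at d₁
        refine wp_sto ?_
        obtain ⟨k₁, k₂⟩ := key (Function.update τ.mem (G + t) 0)
          (by rw [Function.update_self, d₁]) (fun a ha => Function.update_of_ne ha _ _)
        refine ⟨by simp, by simp [hx], ⟨?_, ?_, ?_⟩, ?_⟩
        · simpa [hSτ.h5, hx, hdig] using k₁
        · simpa [hSτ.h5, hx, hdig] using k₂
        · simp [d₂, h', h20, hd]
        · simp
    · intro h
      have hd : ¬ m ^ t ∣ N + 1 := by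
        intro hd
        simp [h20, hd] at h
      have hd' : ¬ m ^ (t + 1) ∣ N + 1 := fun h' => hd ((pow_dvd_pow m t.le_succ).trans h')
      obtain ⟨k₁, k₂⟩ := key τ.mem (by rw [hdig, digit_succ_of_not_dvd hd]) (fun _ _ => rfl)
      refine wp_skip ⟨by simp, by simp [hx], ⟨k₁, k₂, ?_⟩, by simp⟩
      simp [h20, hd, hd']
  · rintro τ hτ ⟨low, dig, h20⟩ ht
    simp [hS.h8] at hτ ht h20
    refine ⟨hτ, low, fun t ht => ?_, h20, ?_⟩
    · rw [dig t ht, if_pos]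
      simpa [hS.h8] using ht
    · have : min k m * 48 ≤ m * 48 := Nat.mul_le_mul_right _ (min_le_right _ _)
      omega

/-- Tries all sequences of equations, given the variables of the search. -/
def searchProg : Prog :=
  asg 18 (num 0) ;; loop 19 8 (sto (var 5 + var 19) (num 0)) ;; asg 17 (num 1) ;;
  whl (var 17) (tupleProg ;; nextProg ;; asg 17 (num 1 - var 20)) ;;
  asg 0 (var 18)

/-- Ensures that counting to `m ^ K` meets every sequence of equations. -/
theorem exists_digits {m : ℕ} : ∀ (K : ℕ) (f : ℕ → ℕ), (∀ t < K, f t < m) →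
    ∃ N < m ^ K, ∀ t < K, N / m ^ t % m = f t
  | 0, _, _ => ⟨0, by simp, by simp⟩
  | K + 1, f, hf => by
    obtain ⟨N, hN, h⟩ := exists_digits K (fun t => f (t + 1)) fun t ht => hf _ (by omega)
    have h0 := hf 0 K.succ_pos
    refine ⟨f 0 + m * N, ?_, fun t ht => ?_⟩
    · have := Nat.mul_le_mul_left m (Nat.succ_le_of_lt hN)
      rw [pow_succ']
      rw [Nat.mul_succ] at this
      omega
    · cases t with
      | zero => simp [Nat.mod_eq_of_lt h0]
      | succ t =>
        rw [pow_succ', ← Nat.div_div_eq_div_mul, Nat.add_mul_div_left _ _ (by omega),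
          Nat.div_eq_of_lt h0, zero_add, h t (by omega)]

theorem run_congr {n m : ℕ} {w : ℕ → ℕ} {M : ℕ → ℕ → ZMod 2} {f g : ℕ → ℕ} : ∀ {t : ℕ},
    (∀ s < t, f s = g s) → run n m w M f t = run n m w M g t
  | 0, _ => rfl
  | t + 1, h => by rw [run, run, run_congr fun s hs => h s (by omega), h t (by omega)]

theorem wp_searchProg {n m k D G : ℕ} {M : ℕ → ℕ → ZMod 2} {w : ℕ → ℕ} {σ : Store}
    (hS : Search n m k D G σ) (hM : Rep σ.mem D n m M w) :
    wp searchProg σ fun τ => (0 < τ.v 0 ↔ ∃ f : ℕ → ℕ, (∀ s < min k m, f s < m) ∧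
        (k : ℤ) ≤ net n m w (run n m w M f (min k m)) 0) ∧
      τ.time ≤ σ.time + 1200 * (m ^ min k m * ((m + 1) * ((n + 1) * (m + 1)))) := by
  -- For `m = 0` the exponent is `0` too, so the loop still runs once, with the empty sequence.
  have hpos : 0 < m ^ min k m := by
    rcases m.eq_zero_or_pos with rfl | h
    · simp
    · exact Nat.pow_pos h
  refine wp_seq (wp_asg (wp_seq (wp_fill (fun _ => 0) (by omega) (by omega)
    (fun _ _ _ _ _ _ => rfl) ?_)))
  intro τ₁ f₁ mem₁ t₁
  simp only [tick_fr, Nat.reduceLeDiff] at f₁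
  have e18 : τ₁.v 18 = 0 := by rw [f₁ 18 (by omega)]; simp
  have f₁ : σ.Fr 17 τ₁ := fun r hr => by
    rw [f₁ r (by omega), set_v, Function.update_of_ne (by omega)]
  simp [hS.h5, hS.h8] at mem₁ t₁
  refine wp_seq (wp_asg (wp_seq ?_))
  refine wp_whl (m ^ min k m) (1000 * ((m + 1) * ((n + 1) * (m + 1))) + 60 * (m + 1) + 4)
    (fun N τ => σ.Fr 17 τ ∧ (τ.v 17 = if N < m ^ min k m then 1 else 0) ∧
      (0 < τ.v 18 ↔ ∃ N' < N, (k : ℤ) ≤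
        net n m w (run n m w M (fun t => N' / m ^ t % m) (min k m)) 0) ∧
      (∀ a < G, τ.mem a = σ.mem a) ∧ ∀ t < min k m, τ.mem (G + t) = N / m ^ t % m)
    (fun _ _ _ h => h) ?_ ?_ ?_
  · rintro N hN τ ⟨hf, h17, h18, low, dig⟩
    rw [if_pos hN] at h17
    have hSτ := hS.of_fr hf (by omega)
    have hMτ : Rep τ.mem D n m M w := hM.congr_lt fun a ha => low a (by have := hS.hG; omega)
    refine ⟨by simp [h17], wp_seq ((wp_tupleProg hSτ hMτ dig
      fun t ht => Nat.mod_lt _ (by omega)).mono ?_)⟩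
    rintro τ₂ ⟨f₂, low₂, h₂, t₂⟩
    refine wp_seq ((wp_nextProg (N := N) (hSτ.of_fr f₂ (by omega)) fun t ht => by
      rw [low₂ _ (by omega), dig t ht]).mono ?_)
    rintro τ₃ ⟨f₃, low₃, dig₃, c₃, t₃⟩
    refine wp_asg ⟨⟨?_, ?_, ?_, ?_, dig₃⟩, ?_⟩
    · simpa using (hf.trans f₂ (by omega)).trans f₃ (by omega)
    -- A carry out of the top digit means that the counter has wrapped around: all sequences have
    -- been tried.
    · have : m ^ min k m ∣ N + 1 ↔ ¬ N + 1 < m ^ min k m :=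
        ⟨fun h => not_lt.2 (Nat.le_of_dvd N.succ_pos h), fun h => by
          rw [show N + 1 = m ^ min k m by omega]⟩
      simp only [tick_v, set_v, Function.update_self, eval_sub, eval_num, eval_var, c₃, this]
      split_ifs <;> rfl
    · simp only [tick_v, set_v]
      rw [Function.update_of_ne (by omega), f₃ 18 (by omega), h₂, h18]
      constructor
      · rintro (⟨N', h, h'⟩ | h)
        · exact ⟨N', by omega, h'⟩
        · exact ⟨N, by omega, h⟩
      · rintro ⟨N', h, h'⟩
        rcases Nat.lt_succ_iff_lt_or_eq.1 h with h | rfl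
        · exact Or.inl ⟨N', h, h'⟩
        · exact Or.inr h'
    · intro a ha
      simp only [tick_mem, set_mem]
      rw [low₃ a ha, low₂ a (by omega), low a ha]
    · simp only [tick_time, set_time, cost_sub, cost_num, cost_var]
      omega
  · refine ⟨by simpa using f₁, by simp [hpos], ?_, fun a ha => ?_, fun t ht => ?_⟩
    · simp [e18]
    · simp [mem₁, overw_lt ha]
    · simp only [tick_mem, set_mem, mem₁]
      rw [overw_add ht]; simp
  · rintro τ ⟨hf, h17, h18, low, dig⟩
    rw [if_neg (lt_irrefl _)] at h17
    refine ⟨h17, fun t ht => wp_asg ⟨?_, ?_⟩⟩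
    · simp only [tick_v, set_v, eval_var, Function.update_self, h18]
      constructor
      · rintro ⟨N, hN, h⟩
        exact ⟨_, fun s hs => Nat.mod_lt _ (by omega), h⟩
      · rintro ⟨f, hf, h⟩
        obtain ⟨N, hN, hd⟩ := exists_digits _ f hf
        exact ⟨N, hN, by rwa [run_congr hd]⟩
    · simp only [tick_time, set_time, cost_var, cost_num] at ht ⊢
      have h₁ : min k m * 13 ≤ m * 13 := Nat.mul_le_mul_right _ (min_le_right _ _)
      generalize hP : (m + 1) * ((n + 1) * (m + 1)) = P at *
      have hmP : m + 1 ≤ P := hP ▸ Nat.le_mul_of_pos_right _ (by positivity)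
      have h₂ : m ^ min k m * (1000 * P + 60 * (m + 1) + 4 + 1 + 1) ≤
          m ^ min k m * (1066 * P) := Nat.mul_le_mul_left _ (by omega)
      have h₃ : P ≤ m ^ min k m * P := Nat.le_mul_of_pos_left _ hpos
      have h₄ : m ^ min k m * (1066 * P) = 1066 * (m ^ min k m * P) := by ring
      omega

/-! ### The complete algorithm and its running time on sequences of numbers -/

/-- Solves the problem, given the parameter, the numbers of variables and equations and the address
of the system. -/
def coreProg : Prog :=
  asg 9 (var 2 + num 2) ;; asg 10 (num 0) ;; loop 19 3 (asg 10 (var 10 + var 9)) ;;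
  asg 11 (var 2 + num 1) ;; asg 8 (var 1 - (var 1 - var 3)) ;; asg 5 (var 4 + var 10) ;;
  asg 6 (var 5 + var 8) ;; asg 7 (var 6 + var 11) ;; searchProg

theorem wp_coreProg {n m k D : ℕ} (S : System n m) {σ : Store} (h1 : σ.v 1 = k)
    (h2 : σ.v 2 = n) (h3 : σ.v 3 = m) (h4 : σ.v 4 = D) (hM : Rep σ.mem D n m S.aug S.wt) :
    wp coreProg σ fun τ => (0 < τ.v 0 ↔ (k : ℤ) ≤ S.maxExcess) ∧
      τ.time ≤ σ.time + 1300 * (m ^ min k m * ((m + 1) * ((n + 1) * (m + 1)))) := by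
  have hpos : 0 < m ^ min k m := by
    rcases m.eq_zero_or_pos with rfl | h
    · simp
    · exact Nat.pow_pos h
  refine wp_seq (wp_asg (wp_seq (wp_asg (wp_seq ?_))))
  refine wp_loop 10 4 (fun i v mem => mem = σ.mem ∧ v 10 = i * (n + 2)) (by omega) (by omega)
    ?_ ?_ ?_
  · simp
  · rintro i hi τ hτ hx ⟨hmem, h10⟩
    refine wp_asg ?_
    simp [hx, hmem, h10, hτ 9, h2]
    ring
  · rintro τ hτ ⟨hmem, h10⟩ ht
    simp [h3] at h10 ht
    have e : ∀ r < 9, τ.v r = σ.v r := fun r hr => by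
      rw [hτ r (by omega)]
      simp only [tick_v, set_v]
      rw [Function.update_of_ne (by omega), Function.update_of_ne (by omega)]
    have e9 : τ.v 9 = n + 2 := by rw [hτ 9 (by omega)]; simp [h2]
    refine wp_seq (wp_asg (wp_seq (wp_asg (wp_seq (wp_asg (wp_seq (wp_asg (wp_seq (wp_asg
      ((wp_searchProg (n := n) (m := m) (k := k) (D := D) (G := D + m * (n + 2)) (M := S.aug)
        (w := S.wt) ?_ ?_).mono ?_))))))))))
    · have hmin : k - (k - m) = min k m := by omega
      constructor
      · constructor <;> simp [e, e9, h1, h2, h3, h4, h10, hmin]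
        omega
      all_goals simp [e, e9, h1, h2, h3, h4, h10, hmin]
    · simpa [hmem] using hM
    · rintro τ' ⟨h, t⟩
      refine ⟨h.trans (S.le_maxExcess_iff k).symm, t.trans ?_⟩
      simp
      generalize hP : (m + 1) * ((n + 1) * (m + 1)) = P at *
      have hmP : m + 1 ≤ P := hP ▸ Nat.le_mul_of_pos_right _ (by positivity)
      have h₃ : P ≤ m ^ min k m * P := Nat.le_mul_of_pos_left _ hpos
      omega

theorem start_rel (x : List ℕ) :
    Rel (State.start x) ⟨fun r => if r = 0 then x.length else 0, fun i => x.getD i 0, 0⟩ :=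
  ⟨fun r => by simp [State.start], rfl⟩

theorem answers_of_wp {P : Prog} {x : List ℕ} {T : ℕ} {q : Prop}
    (h : wp P ⟨fun r => if r = 0 then x.length else 0, fun i => x.getD i 0, 0⟩ fun τ =>
      (0 < τ.v 0 ↔ q) ∧ τ.time ≤ T) : ∃ t ≤ T, P.Answers x t q := by
  obtain ⟨t, s', τ, e, r, ht, hq, hT⟩ := h _ (start_rel x)
  refine ⟨t, by simp at ht; omega, s', e, ?_⟩
  rw [← hq, ← r.1 0]

theorem getD_flatten_ofFn {R : ℕ} : ∀ {m : ℕ} (g : Fin m → List ℕ), (∀ j, (g j).length = R) →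
    ∀ (i : ℕ) (hi : i < m) (c : ℕ), c < R →
      (List.ofFn g).flatten.getD (i * R + c) 0 = (g ⟨i, hi⟩).getD c 0
  | 0, _, _, _, hi, _, _ => absurd hi (by omega)
  | m + 1, g, hg, i, hi, c, hc => by
    rw [List.ofFn_succ, List.flatten_cons]
    cases i with
    | zero =>
      rw [Nat.zero_mul, Nat.zero_add, List.getD_append _ _ _ _ (by rw [hg]; exact hc)]
      rfl
    | succ i =>
      rw [List.getD_append_right _ _ _ _ (by rw [hg, Nat.succ_mul]; omega), hg,
        show (i + 1) * R + c - R = i * R + c by rw [Nat.succ_mul]; omega,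
        getD_flatten_ofFn _ (fun j => hg _) i (by omega) c hc]
      rfl

theorem rep_toWords {n m k : ℕ} (S : System n m) :
    Rep (fun i => (k :: S.toWords).getD i 0) 3 n m S.aug S.wt := by
  intro i hi
  -- The offset `3` skips the cells with `k`, `n` and `m`.
  have key : ∀ c < n + 2, (k :: S.toWords).getD (3 + i * (n + 2) + c) 0 =
      ((List.ofFn fun c => (S.A ⟨i, hi⟩ c).val) ++ [(S.b ⟨i, hi⟩).val, S.w ⟨i, hi⟩]).getD c 0 := by
    intro c hc
    rw [← getD_flatten_ofFn (R := n + 2) (fun j => (List.ofFn fun c => (S.A j c).val) ++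
      [(S.b j).val, S.w j]) (by simp) i hi c hc,
      show 3 + i * (n + 2) + c = i * (n + 2) + c + 1 + 1 + 1 by ring]
    simp [System.toWords]
  refine ⟨fun c hc => ?_, ?_⟩ <;> beta_reduce
  · rw [key c (by omega)]
    rcases hc.lt_or_eq with hc | rfl
    · rw [List.getD_append _ _ _ _ (by simpa using hc)]
      simp [System.aug, hi, hc]
    · rw [List.getD_append_right _ _ _ _ (by simp)]
      simp [System.aug, hi]
  · rw [key (n + 1) (by omega), List.getD_append_right _ _ _ _ (by simp)]
    simp [System.wt, hi]

/-- Solves the problem for systems given as sequences of numbers. -/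
def wordsProg : Prog :=
  asg 1 (ld (num 0)) ;; asg 2 (ld (num 1)) ;; asg 3 (ld (num 2)) ;; asg 4 (num 3) ;; coreProg

theorem wordsProg_answers {n m : ℕ} (k : ℕ) (S : System n m) :
    ∃ t ≤ 11 + 1300 * (m ^ min k m * ((m + 1) * ((n + 1) * (m + 1)))),
      wordsProg.Answers (k :: S.toWords) t ((k : ℤ) ≤ S.maxExcess) := by
  refine answers_of_wp (wp_seq (wp_asg (wp_seq (wp_asg (wp_seq (wp_asg (wp_seq (wp_asg
    ((wp_coreProg (k := k) (D := 3) S ?_ ?_ ?_ ?_ ?_).mono ?_)))))))))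
  · simp
  · simp [System.toWords]
  · simp [System.toWords]
  · simp
  · exact rep_toWords S
  · rintro τ ⟨h, t⟩
    exact ⟨h, by simpa using t⟩

/-- An equation exists and contains a variable, so `n` is positive as well; `m + 1 ≤ 2 * m` and `n +
1 ≤ 2 * n` cost a factor 8, and `8 * 1300 + 11 = 10411`. -/
theorem wordsProg_bound {n m k : ℕ} (S : System n m) (hm : 0 < m) :
    11 + 1300 * (m ^ min k m * ((m + 1) * ((n + 1) * (m + 1)))) ≤ 10411 * (n * m ^ (k + 2)) := by
  have hn : 0 < n := by
    obtain ⟨c, -⟩ := S.row_ne_zero ⟨0, hm⟩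
    exact c.pos
  have h₁ : m ^ min k m ≤ m ^ k := Nat.pow_le_pow_right hm (min_le_left _ _)
  have h₂ : (m + 1) * ((n + 1) * (m + 1)) ≤ (2 * m) * ((2 * n) * (2 * m)) := by
    gcongr <;> omega
  have h₃ := Nat.mul_le_mul h₁ h₂
  have h₄ : m ^ k * ((2 * m) * ((2 * n) * (2 * m))) = 8 * (n * m ^ (k + 2)) := by ring
  have h₅ : 0 < n * m ^ (k + 2) := by positivity
  omega

theorem exists_prog_toWords : ∃ (P : Prog) (C c : ℕ), ∀ (n m k : ℕ) (S : System n m), ∃ t : ℕ,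
    P.Answers (k :: S.toWords) t ((k : ℤ) ≤ S.maxExcess) ∧
      (0 < m → t ≤ C * (n ^ c * m ^ (k + c))) ∧ (0 < m → n ≤ m → t ≤ C * m ^ (k + c)) := by
  -- The bound is linear in `n`; when `n ≤ m` this factor raises the exponent `k + 2` to `k + 3`.
  refine ⟨wordsProg, 10411, 3, fun n m k S => ?_⟩
  obtain ⟨t, ht, h⟩ := wordsProg_answers k S
  refine ⟨t, h, fun hm => ?_, fun hm hnm => ?_⟩
  · refine (ht.trans (wordsProg_bound S hm)).trans (Nat.mul_le_mul_left _ (Nat.mul_le_mul ?_ ?_))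
    · exact Nat.le_self_pow (by omega) n
    · exact Nat.pow_le_pow_right hm (by omega)
  · refine (ht.trans (wordsProg_bound S hm)).trans (Nat.mul_le_mul_left _ ?_)
    calc n * m ^ (k + 2) ≤ m * m ^ (k + 2) := Nat.mul_le_mul_right _ hnm
      _ = m ^ (k + 3) := by ring

/-! ### Encodings by bit strings -/

/-- From position `p` on, the stream `B` begins with the given list. -/
def Reads (B : ℕ → Bool) (p : ℕ) : List Bool → Prop
  | [] => True
  | b :: l => B p = b ∧ Reads B (p + 1) l

section

variable {B : ℕ → Bool}

theorem reads_append : ∀ {l l' : List Bool} {p : ℕ},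
    Reads B p (l ++ l') ↔ Reads B p l ∧ Reads B (p + l.length) l'
  | [], l', p => by simp [Reads]
  | b :: l, l', p => by
    simp only [List.cons_append, Reads, reads_append, List.length_cons, and_assoc]
    rw [Nat.add_assoc, Nat.add_comm 1]

theorem Reads.unique : ∀ {l l' : List Bool} {p : ℕ}, Reads B p l → Reads B p l' →
    l.length = l'.length → l = l'
  | [], [], _, _, _, _ => rfl
  | [], _ :: _, _, _, _, h => by simp at h
  | _ :: _, [], _, _, _, h => by simp at h
  | b :: l, b' :: l', p, h, h', e => by
    rw [← h.1, ← h'.1, h.2.unique h'.2 (by simpa using e)]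

theorem reads_map_range {a : ℕ → Bool} {p : ℕ} : ∀ {N : ℕ},
    Reads B p ((List.range N).map a) ↔ ∀ c < N, B (p + c) = a c
  | 0 => by simp [Reads]
  | N + 1 => by
    rw [List.range_succ, List.map_append, reads_append, reads_map_range,
      Nat.forall_lt_succ_right]
    simp [Reads]

theorem reads_unary {p : ℕ} : ∀ {N : ℕ}, Reads B p (List.replicate N true ++ [false]) ↔
    (∀ i < N, B (p + i) = true) ∧ B (p + N) = false := fun {N} => by
  have : List.replicate N true = (List.range N).map fun _ => true := by simp
  rw [this, reads_append, reads_map_range]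
  simp [Reads]

theorem unary_unique {p N N' : ℕ} (h : Reads B p (List.replicate N true ++ [false]))
    (h' : Reads B p (List.replicate N' true ++ [false])) : N = N' := by
  rw [reads_unary] at h h'
  rcases lt_trichotomy N N' with hlt | h₁ | hlt
  · have := h'.1 N hlt; simp [h.2] at this
  · exact h₁
  · have := h.1 N' hlt; simp [h'.2] at this

/-- The encoding of a sequence of binary digits. -/
def encDigits (ds : List Bool) : List Bool := (ds.flatMap fun d => [true, d]) ++ [false]

theorem length_encDigits (ds : List Bool) : (encDigits ds).length = 2 * ds.length + 1 := by
  induction ds with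
  | nil => rfl
  | cons d ds ih => simp [encDigits] at ih ⊢; omega

theorem reads_encDigits_cons {d : Bool} {ds : List Bool} {p : ℕ} :
    Reads B p (encDigits (d :: ds)) ↔
      B p = true ∧ B (p + 1) = d ∧ Reads B (p + 2) (encDigits ds) := Iff.rfl

theorem digits_unique : ∀ {ds ds' : List Bool} {p : ℕ}, Reads B p (encDigits ds) →
    Reads B p (encDigits ds') → ds = ds'
  | [], [], _, _, _ => rfl
  | [], _ :: _, _, h, h' => by have := h.1.symm.trans h'.1; simp at this
  | _ :: _, [], _, h, h' => by have := h.1.symm.trans h'.1; simp at this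
  | d :: ds, d' :: ds', p, h, h' => by
    rw [reads_encDigits_cons] at h h'
    rw [← h.2.1, ← h'.2.1, digits_unique h.2.2 h'.2.2]

/-- Since the stream is eventually zero, every block is closed. Parsing therefore never gets stuck,
and validity can be tested afterwards. -/
theorem exists_unary {L : ℕ} (hB : ∀ p, L ≤ p → B p = false) (p : ℕ) :
    ∃ N ≤ L, Reads B p (List.replicate N true ++ [false]) := by
  have h : ∃ N, B (p + N) = false := ⟨L, hB _ (by omega)⟩
  classical
  refine ⟨Nat.find h, Nat.find_min' h (hB _ (by omega)), reads_unary.2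
    ⟨fun i hi => ?_, Nat.find_spec h⟩⟩
  simpa using Nat.find_min h hi

theorem exists_encDigits {L : ℕ} (hB : ∀ p, L ≤ p → B p = false) (p : ℕ) :
    ∃ ds, ds.length ≤ L ∧ Reads B p (encDigits ds) := by
  suffices H : ∀ d p, L ≤ p + d → ∃ ds, ds.length ≤ d ∧ Reads B p (encDigits ds) from
    H L p (by omega)
  intro d
  induction d with
  | zero => exact fun p hp => ⟨[], by simp, hB p hp, trivial⟩
  | succ d ih =>
    intro p hp
    cases hb : B p with
    | false => exact ⟨[], by simp, hb, trivial⟩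
    | true =>
      obtain ⟨ds, h, h'⟩ := ih (p + 2) (by omega)
      exact ⟨B (p + 1) :: ds, by simpa using h, reads_encDigits_cons.2 ⟨hb, rfl, h'⟩⟩

/-! ### Binary weights in canonical form -/

/-- The number with the given binary digits, the least significant one first. -/
def ofBin : List Bool → ℕ
  | [] => 0
  | d :: ds => d.toNat + 2 * ofBin ds

theorem ofBin_cons (d : Bool) (ds : List Bool) : ofBin (d :: ds) = Nat.bit d (ofBin ds) := by
  cases d <;> simp [ofBin, Nat.bit]; omega

theorem getLastD_true : ∀ {ds : List Bool} {d : Bool}, ds.getLastD d = true →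
    ds.getLastD true = true
  | [], _, _ => rfl
  | _ :: _, _, h => by rw [List.getLastD_cons] at h ⊢; exact h

/-- A digit list is canonical if its most significant digit is `1`; the default `true` admits the
empty list, which stands for zero. -/
theorem bits_ofBin : ∀ {ds : List Bool}, ds.getLastD true = true → (ofBin ds).bits = ds
  | [], _ => by simp [ofBin]
  | d :: ds, h => by
    rw [List.getLastD_cons] at h
    have ih : (ofBin ds).bits = ds := bits_ofBin (getLastD_true h)
    rw [ofBin_cons, Nat.bits_append_bit, ih]
    intro h0
    rw [h0, Nat.zero_bits] at ih
    subst ih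
    simpa using h

theorem getLastD_bits {w : ℕ} (hw : 0 < w) (d : Bool) : w.bits.getLastD d = true := by
  induction w using Nat.strong_induction_on generalizing d with
  | _ w ih =>
    have hb : w.bits = w.bodd :: w.div2.bits := by
      conv_lhs => rw [← Nat.bit_bodd_div2 w]
      refine Nat.bits_append_bit _ _ fun h0 => ?_
      have := Nat.bodd_add_div2 w
      cases hb : w.bodd
      · simp [h0, hb] at this; omega
      · rfl
    rw [hb, List.getLastD_cons]
    rcases Nat.eq_zero_or_pos w.div2 with h0 | h0
    · have := Nat.bodd_add_div2 w
      cases hb : w.bodd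
      · simp [h0, hb] at this; omega
      · simp [h0]
    · exact ih _ (by rw [Nat.div2_val]; omega) h0 _

/-! ### Rows, systems and unique decoding -/

/-- An equation as it is written in a bit string: the coefficients, followed by the right-hand side,
and the digits of the weight. -/
structure RawRow where
  a : ℕ → Bool
  ds : List Bool

def encRow (n : ℕ) (r : RawRow) : List Bool := (List.range (n + 1)).map r.a ++ encDigits r.ds

def encRows (n : ℕ) (ρ : ℕ → RawRow) : ℕ → List Bool
  | 0 => []
  | m + 1 => encRows n ρ m ++ encRow n (ρ m)

def encSystem (n m : ℕ) (ρ : ℕ → RawRow) : List Bool :=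
  (List.replicate n true ++ [false]) ++ ((List.replicate m true ++ [false]) ++ encRows n ρ m)

/-- Two sequences of equations agree in all that matters. -/
def RowsEq (n m : ℕ) (ρ ρ' : ℕ → RawRow) : Prop :=
  ∀ j < m, (∀ c < n + 1, (ρ j).a c = (ρ' j).a c) ∧ (ρ j).ds = (ρ' j).ds

theorem encRows_congr {n : ℕ} {ρ ρ' : ℕ → RawRow} : ∀ {m : ℕ}, RowsEq n m ρ ρ' →
    encRows n ρ m = encRows n ρ' m
  | 0, _ => rfl
  | m + 1, h => by
    have h₁ := h m (Nat.lt_succ_self m)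
    rw [encRows, encRows, encRows_congr fun j hj => h j (by omega), encRow, encRow, h₁.2,
      List.map_congr_left fun c hc => h₁.1 c (List.mem_range.1 hc)]

theorem rows_unique {n p : ℕ} {ρ ρ' : ℕ → RawRow} : ∀ {m : ℕ}, Reads B p (encRows n ρ m) →
    Reads B p (encRows n ρ' m) → RowsEq n m ρ ρ'
  | 0, _, _ => fun j hj => absurd hj (by omega)
  | m + 1, h, h' => by
    rw [encRows, reads_append] at h h'
    have ih := rows_unique h.1 h'.1
    -- The earlier rows agree, so both readings of the last row start at the same position.
    rw [encRows_congr ih] at h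
    have h₂ := h.2
    have h₂' := h'.2
    rw [encRow, reads_append, reads_map_range] at h₂ h₂'
    simp only [List.length_map, List.length_range] at h₂ h₂'
    intro j hj
    rcases Nat.lt_succ_iff_lt_or_eq.1 hj with hj | rfl
    · exact ih j hj
    · exact ⟨fun c hc => (h₂.1 c hc).symm.trans (h₂'.1 c hc), digits_unique h₂.2 h₂'.2⟩

theorem encSystem_unique {n m n' m' p : ℕ} {ρ ρ' : ℕ → RawRow}
    (h : Reads B p (encSystem n m ρ)) (h' : Reads B p (encSystem n' m' ρ')) :
    n = n' ∧ m = m' ∧ RowsEq n m ρ ρ' := by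
  obtain ⟨h₁, h₂⟩ := reads_append.1 h
  obtain ⟨h₁', h₂'⟩ := reads_append.1 h'
  obtain rfl := unary_unique h₁ h₁'
  obtain ⟨h₃, h₄⟩ := reads_append.1 h₂
  obtain ⟨h₃', h₄'⟩ := reads_append.1 h₂'
  obtain rfl := unary_unique h₃ h₃'
  exact ⟨rfl, rfl, rows_unique h₄ h₄'⟩

end

/-- A system as it is written in a bit string. -/
def System.raw {n m : ℕ} (S : System n m) (j : ℕ) : RawRow :=
  ⟨fun c => decide (S.aug j c = 1), (S.wt j).bits⟩

theorem encRows_eq_flatten {n : ℕ} {ρ : ℕ → RawRow} : ∀ {m : ℕ},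
    encRows n ρ m = (List.ofFn fun j : Fin m => encRow n (ρ j)).flatten
  | 0 => rfl
  | m + 1 => by
    rw [List.ofFn_succ', List.concat_eq_append, List.flatten_append, encRows, encRows_eq_flatten]
    simp

theorem System.toBits_eq {n m : ℕ} (S : System n m) : S.toBits = encSystem n m S.raw := by
  rw [toBits, encSystem, encRows_eq_flatten, List.append_assoc]
  congr 4
  funext j
  have : ((List.range (n + 1)).map (S.raw j).a) =
      (List.ofFn fun i => decide (S.A j i = 1)) ++ [decide (S.b j = 1)] := by
    rw [List.range_succ, List.map_append]
    congr 1
    · refine List.ext_getElem (by simp) fun i h₁ h₂ => ?_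
      have : i < n := by simpa using h₁
      simp [raw, aug, this]
    · simp [raw, aug]
  rw [encRow, this, encDigits]
  simp [raw, wt]

theorem System.eq_of_raw {n m : ℕ} {S S' : System n m} (h : RowsEq n m S.raw S'.raw) :
    S = S' := by
  have key : ∀ a b : ZMod 2, decide (a = 1) = decide (b = 1) → a = b := by decide
  have hA : S.A = S'.A := by
    funext j c
    have := (h j j.2).1 c (by omega)
    exact key _ _ (by simpa [raw, aug] using this)
  have hb : S.b = S'.b := by
    funext j
    have := (h j j.2).1 n (by omega)
    exact key _ _ (by simpa [raw, aug] using this)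
  have hw : S.w = S'.w := by
    funext j
    have := congrArg ofBin (h j j.2).2
    have h' : ∀ w : ℕ, ofBin w.bits = w := fun w => by
      induction w using Nat.binaryRec' with
      | zero => simp [ofBin]
      | bit b w hb ih => rw [Nat.bits_append_bit _ _ hb, ofBin_cons, ih]
    simpa [raw, wt, h'] using this
  cases S; cases S'; cases hA; cases hb; cases hw; rfl

/-- The rows of a sequence that encode equations with variables and positive weights. -/
def RawRow.Good (n : ℕ) (r : RawRow) : Prop :=
  (∃ c < n, r.a c = true) ∧ r.ds.getLastD false = true

theorem System.raw_good {n m : ℕ} (S : System n m) {j : ℕ} (hj : j < m) :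
    (S.raw j).Good n := by
  obtain ⟨c, hc⟩ := S.row_ne_zero ⟨j, hj⟩
  refine ⟨⟨c, c.2, ?_⟩, getLastD_bits ?_ _⟩
  · simpa [raw, aug, hj] using zmod2_eq_one hc
  · simpa [wt, hj] using S.w_pos ⟨j, hj⟩

/-- The system given by good rows. -/
def systemOfRaw (n m : ℕ) (ρ : ℕ → RawRow) (h : ∀ j < m, (ρ j).Good n) : System n m where
  A j c := if (ρ j).a c then 1 else 0
  b j := if (ρ j).a n then 1 else 0
  w j := ofBin (ρ j).ds
  w_pos j := by
    have h₁ := (h j j.2).2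
    have h₂ : (ρ j).ds ≠ [] := fun h' => by simp [h'] at h₁
    refine Nat.pos_of_ne_zero fun h0 => h₂ ?_
    have := bits_ofBin (getLastD_true h₁)
    rw [← this, h0, Nat.zero_bits]
  row_ne_zero j := by
    obtain ⟨c, hc, h'⟩ := (h j j.2).1
    exact ⟨⟨c, hc⟩, by simp [h']⟩

/-- Good rows carry canonical digit lists, so passing to the weight and back loses nothing. -/
theorem systemOfRaw_raw {n m : ℕ} {ρ : ℕ → RawRow} (h : ∀ j < m, (ρ j).Good n) :
    RowsEq n m (systemOfRaw n m ρ h).raw ρ := by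
  intro j hj
  refine ⟨fun c hc => ?_, ?_⟩
  · rcases (Nat.lt_succ_iff.1 hc).lt_or_eq with hc | rfl
    · cases hb : (ρ j).a c <;> simp [System.raw, System.aug, systemOfRaw, hj, hc, hb]
    · cases hb : (ρ j).a c <;> simp [System.raw, System.aug, systemOfRaw, hj, hb]
  · have h₁ := (h j hj).2
    have : (ofBin (ρ j).ds).bits = (ρ j).ds := bits_ofBin (getLastD_true h₁)
    simpa [System.raw, System.wt, systemOfRaw, hj] using this

/-! ### Reading bit strings -/

/-- The memory cells `1, …, L - 1` hold the bits of the stream `B`, which vanishes from position `L`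
on. -/
structure Inp (L : ℕ) (B : ℕ → Bool) (σ : Store) : Prop where
  len : σ.v 0 = L
  bit : ∀ p, 1 ≤ p → p < L → σ.mem p = (B p).toNat
  zero : ∀ p, L ≤ p → B p = false

theorem Inp.congr {L : ℕ} {B : ℕ → Bool} {σ τ : Store} (h : Inp L B σ) (h0 : τ.v 0 = σ.v 0)
    (hm : ∀ a < L, τ.mem a = σ.mem a) : Inp L B τ :=
  ⟨h0.trans h.len, fun p h₁ h₂ => by rw [hm p h₂, h.bit p h₁ h₂], h.zero⟩

/-- Variable 16 gets the bit at the position given by variable 13, which is then increased. -/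
def getBit : Prog :=
  ite (var 0 - var 13) (asg 16 (ld (var 13))) (asg 16 (num 0)) ;; asg 13 (var 13 + num 1)

/-- Beyond the input the program supplies zeros, as the stream does. Memory behind the input may
thus be reused during parsing. -/
theorem wp_getBit {L p : ℕ} {B : ℕ → Bool} {σ : Store} {Q : Store → Prop} (hI : Inp L B σ)
    (hp : σ.v 13 = p) (h1 : 1 ≤ p)
    (hQ : ∀ t ≤ σ.time + 15,
      Q ⟨Function.update (Function.update σ.v 16 (B p).toNat) 13 (p + 1), σ.mem, t⟩) :
    wp getBit σ Q := by
  refine wp_seq (wp_ite (fun h => wp_asg (wp_asg ?_)) fun h => wp_asg (wp_asg ?_))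
  · have h' : p < L := by simpa [hI.len, hp] using h
    simpa [Store.set, Store.tick, hp, hI.bit p h1 h'] using
      hQ (σ.time + 4 + 3 + 4) (by omega)
  · have h' : L ≤ p := by simpa [hI.len, hp, Nat.sub_eq_zero_iff_le] using h
    simpa [Store.set, Store.tick, hp, hI.zero p h'] using
      hQ (σ.time + 4 + 2 + 4) (by omega)

/-- Variable `y` gets the length of the next block of ones. -/
def unaryProg (y : ℕ) : Prog :=
  asg y (num 0) ;; getBit ;; whl (var 16) (asg y (var y + num 1) ;; getBit)

theorem wp_unaryProg {L p y N : ℕ} {B : ℕ → Bool} {σ : Store} (hI : Inp L B σ)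
    (hp : σ.v 13 = p) (h1 : 1 ≤ p) (hy : 0 < y) (hy' : y < 13)
    (hN : Reads B p (List.replicate N true ++ [false])) :
    wp (unaryProg y) σ fun τ => τ.v y = N ∧ τ.v 13 = p + N + 1 ∧ τ.mem = σ.mem ∧
      (∀ r < 13, r ≠ y → τ.v r = σ.v r) ∧ τ.time ≤ σ.time + 30 * (N + 1) := by
  rw [reads_unary] at hN
  have n1 : y ≠ 13 := by omega
  have n2 : y ≠ 16 := by omega
  have n3 : 13 ≠ y := by omega
  have n4 : 16 ≠ y := by omega
  have n5 : 0 ≠ y := by omega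
  refine wp_seq (wp_asg (wp_seq (wp_getBit (p := p) (hI.congr (by simp [n5]) fun _ _ => rfl)
    (by simp [hp, n3]) h1 fun t ht => ?_)))
  simp at ht
  refine wp_whl N 20 (fun i τ => τ.v y = i ∧ τ.v 13 = p + i + 1 ∧
    τ.v 16 = (B (p + i)).toNat ∧ τ.mem = σ.mem ∧ ∀ r < 13, r ≠ y → τ.v r = σ.v r)
    (fun _ _ _ h => h) ?_ ?_ ?_
  · rintro i hi τ ⟨hy, h13, h16, hmem, hfr⟩
    refine ⟨by simp [h16, hN.1 i hi], wp_seq (wp_asg (wp_getBit (p := p + i + 1)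
      (hI.congr (by simp [n5, hfr 0 _ n5]) fun _ _ => by simp [hmem]) (by simp [n3, h13])
      (by omega) fun t ht => ?_))⟩
    simp at ht
    refine ⟨⟨?_, ?_, ?_, hmem, fun r hr hry => ?_⟩, ?_⟩
    · simp [n1, n2, hy]
    · simp; omega
    · simp [Nat.add_assoc]
    · have : r ≠ 13 := by omega
      have : r ≠ 16 := by omega
      simp [*]
    · simp; omega
  · refine ⟨by simp [n1, n2], by simp, by simp, rfl, fun r hr hry => ?_⟩
    have : r ≠ 13 := by omega
    have : r ≠ 16 := by omega
    simp [*]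
  · rintro τ ⟨hy, h13, h16, hmem, hfr⟩
    refine ⟨by simp [h16, hN.2], fun t' ht' => ⟨hy, h13, hmem, hfr, ?_⟩⟩
    simp at ht' ⊢
    omega

/-- Variable 17 gets the number whose digits follow, variable 19 its last digit. -/
def digitsProg : Prog :=
  asg 17 (num 0) ;; asg 18 (num 1) ;; asg 19 (num 0) ;; getBit ;;
    whl (var 16) (getBit ;; ite (var 16) (asg 17 (var 17 + var 18)) skip ;; asg 19 (var 16) ;;
      asg 18 (var 18 + var 18) ;; getBit)

/-- Variable 18 is the place value, doubled in every round, and 17 accumulates the number. The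
marker bit at `p` is already in variable 16, so the reading position is `p + 1`. -/
theorem wp_digits_loop {L : ℕ} {B : ℕ → Bool} : ∀ (ds : List Bool) {p : ℕ} {b : Bool} {σ : Store},
    Inp L B σ → σ.v 13 = p + 1 → 1 ≤ p → σ.v 16 = (B p).toNat → σ.v 19 = b.toNat →
    Reads B p (encDigits ds) →
    wp (whl (var 16) (getBit ;; ite (var 16) (asg 17 (var 17 + var 18)) skip ;; asg 19 (var 16) ;;
      asg 18 (var 18 + var 18) ;; getBit)) σ fun τ => (∀ r < 16, r ≠ 13 → τ.v r = σ.v r) ∧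
        τ.mem = σ.mem ∧ τ.v 13 = p + (2 * ds.length + 1) ∧
        τ.v 17 = σ.v 17 + σ.v 18 * ofBin ds ∧ τ.v 19 = (ds.getLastD b).toNat ∧
        τ.time ≤ σ.time + 60 * (ds.length + 1)
  | [], p, b, σ, hI, h13, h1, h16, h19, hR => by
    have : B p = false := hR.1
    exact wp_whl_done (by simp [h16, this]) (by simp [h13, h19, ofBin])
  | d :: ds, p, b, σ, hI, h13, h1, h16, h19, hR => by
    rw [reads_encDigits_cons] at hR
    obtain ⟨r₁, r₂, r₃⟩ := hR
    -- What one round must achieve for the induction hypothesis to finish; shared by the branches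
    -- for digit `1` and digit `0`.
    have key : ∀ τ : Store, (∀ r < 16, r ≠ 13 → τ.v r = σ.v r) → τ.mem = σ.mem →
        τ.v 13 = p + 2 + 1 → τ.v 16 = (B (p + 2)).toNat → τ.v 19 = d.toNat →
        τ.v 17 = σ.v 17 + d.toNat * σ.v 18 → τ.v 18 = σ.v 18 + σ.v 18 →
        τ.time ≤ σ.time + 60 → _ := fun τ a₁ a₂ a₃ a₄ a₅ a₆ a₇ a₈ =>
      (wp_digits_loop ds (hI.congr (a₁ 0 (by omega) (by omega)) fun _ _ => by rw [a₂]) a₃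
        (by omega) a₄ a₅ r₃).mono (R := fun τ => (∀ r < 16, r ≠ 13 → τ.v r = σ.v r) ∧
          τ.mem = σ.mem ∧ τ.v 13 = p + (2 * (d :: ds).length + 1) ∧
          τ.v 17 = σ.v 17 + σ.v 18 * ofBin (d :: ds) ∧
          τ.v 19 = ((d :: ds).getLastD b).toNat ∧
          τ.time ≤ σ.time + 60 * ((d :: ds).length + 1)) fun ρ ⟨b₁, b₂, b₃, b₄, b₅, b₆⟩ =>
            ⟨fun r h h' => (b₁ r h h').trans (a₁ r h h'), b₂.trans a₂,
              by rw [b₃, List.length_cons]; omega,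
              by rw [b₄, a₆, a₇, ofBin]; ring, by rw [b₅, List.getLastD_cons],
              by rw [List.length_cons]; omega⟩
    refine wp_whl_step (by simp [h16, r₁]) (wp_seq (wp_getBit (p := p + 1)
      (hI.congr rfl fun _ _ => rfl) h13 (by omega) fun t ht => ?_))
    simp at ht
    rw [r₂]
    refine wp_seq (wp_ite (fun h => wp_asg (wp_seq (wp_asg (wp_seq (wp_asg (wp_getBit (L := L)
      (p := p + 2) (hI.congr ?_ fun _ _ => rfl) ?_ (by omega) fun t ht' => key _ ?_ rfl ?_ ?_ ?_ ?_
        ?_ ?_)))))) fun h => wp_skip (wp_seq (wp_asg (wp_seq (wp_asg (wp_getBit (L := L)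
      (p := p + 2) (hI.congr ?_ fun _ _ => rfl) ?_ (by omega) fun t ht' => key _ ?_ rfl ?_ ?_ ?_ ?_
        ?_ ?_))))))
    all_goals first
      | (intro r hr hr'
         have : r ≠ 16 := by omega
         have : r ≠ 17 := by omega
         have : r ≠ 18 := by omega
         have : r ≠ 19 := by omega
         simp [*])
      | (simp at ht'; dsimp only; omega)
      | (simp at h; simp [h]; done)
      | (cases d <;> simp at h ⊢)

theorem wp_digitsProg {L p : ℕ} {B : ℕ → Bool} {ds : List Bool} {σ : Store} (hI : Inp L B σ)
    (hp : σ.v 13 = p) (h1 : 1 ≤ p) (hR : Reads B p (encDigits ds)) :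
    wp digitsProg σ fun τ => (∀ r < 16, r ≠ 13 → τ.v r = σ.v r) ∧
        τ.mem = σ.mem ∧ τ.v 13 = p + (2 * ds.length + 1) ∧
        τ.v 17 = ofBin ds ∧ τ.v 19 = (ds.getLastD false).toNat ∧
        τ.time ≤ σ.time + 60 * (ds.length + 2) := by
  refine wp_seq (wp_asg (wp_seq (wp_asg (wp_seq (wp_asg (wp_seq (wp_getBit (L := L) (p := p)
    (hI.congr (by simp) fun _ _ => rfl) (by simp [hp]) h1 fun t ht => ?_)))))))
  refine (wp_digits_loop (L := L) (p := p) (b := false) ds ?_ ?_ h1 ?_ ?_ hR).mono ?_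
  · exact hI.congr (by simp) fun _ _ => rfl
  · simp
  · simp
  · simp
  rintro τ ⟨b₁, b₂, b₃, b₄, b₅, b₆⟩
  refine ⟨fun r hr hr' => ?_, b₂, b₃, by simpa using b₄, b₅, ?_⟩
  · have : r ≠ 16 := by omega
    have : r ≠ 17 := by omega
    have : r ≠ 18 := by omega
    have : r ≠ 19 := by omega
    simp [b₁ r hr hr', *]
  · simp at ht b₆
    omega

/-- Reads an equation and writes it to the cells from the address in variable 14 on; variable 12
becomes positive if there is something wrong with it. -/
def rowProg : Prog :=
  asg 15 (num 0) ;;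
  loop 20 2 (getBit ;; sto (var 14) (var 16) ;; asg 14 (var 14 + num 1) ;;
    asg 15 (var 15 + var 16)) ;;
  getBit ;; sto (var 14) (var 16) ;; asg 14 (var 14 + num 1) ;;
  digitsProg ;; sto (var 14) (var 17) ;; asg 14 (var 14 + num 1) ;;
  ite (var 15) skip (asg 12 (num 1)) ;; ite (var 19) skip (asg 12 (num 1))

theorem length_encRow (n : ℕ) (r : RawRow) :
    (encRow n r).length = n + 1 + (2 * r.ds.length + 1) := by
  simp [encRow, length_encDigits]

theorem wp_rowProg {L n p q : ℕ} {B : ℕ → Bool} {r : RawRow} {σ : Store} (hI : Inp L B σ)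
    (h2 : σ.v 2 = n) (hp : σ.v 13 = p) (h1 : 1 ≤ p) (hq : σ.v 14 = q) (hLq : L ≤ q)
    (hR : Reads B p (encRow n r)) (hds : r.ds.length ≤ L) :
    wp rowProg σ fun τ => σ.Fr 12 τ ∧ (0 < τ.v 12 ↔ 0 < σ.v 12 ∨ ¬ r.Good n) ∧
      τ.v 13 = p + (encRow n r).length ∧ τ.v 14 = q + (n + 2) ∧
      (∀ a < q, τ.mem a = σ.mem a) ∧ (∀ c < n + 1, τ.mem (q + c) = (r.a c).toNat) ∧
      τ.mem (q + (n + 1)) = ofBin r.ds ∧ τ.time ≤ σ.time + (40 * n + 60 * L + 200) := by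
  obtain ⟨ha, hd⟩ := reads_append.1 hR
  rw [reads_map_range] at ha
  simp only [List.length_map, List.length_range] at hd
  refine wp_seq (wp_asg (wp_seq ?_))
  refine wp_loop 13 32 (fun c v mem => v 13 = p + c ∧ v 14 = q + c ∧
    (0 < v 15 ↔ ∃ c' < c, r.a c' = true) ∧ mem = overw σ.mem q c fun c => (r.a c).toNat)
    (by omega) (by omega) ?_ ?_ ?_
  · simp [hp, hq, overw_zero]
  · rintro c hc τ hτ hx ⟨h13, h14, h15, hmem⟩
    simp [h2] at hc
    simp only [tick_fr, set_fr, Nat.reduceLeDiff] at hτ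
    refine wp_seq (wp_getBit (L := L) (hI.congr (hτ 0 (by omega)) fun a h => by
      rw [hmem, overw_lt (by omega)]) h13 (by omega) fun t ht => ?_)
    rw [ha c (by omega)]
    refine wp_seq (wp_sto (wp_seq (wp_asg (wp_asg ⟨?_, ?_, ⟨?_, ?_, ?_, ?_⟩, ?_⟩))))
    · intro s hs
      have : s ≠ 13 := by omega
      have : s ≠ 14 := by omega
      have : s ≠ 15 := by omega
      have : s ≠ 16 := by omega
      simp [*]
    · simp [hx]
    · simp; omega
    · simp [h14]; omega
    · have : (∃ c' < c + 1, r.a c' = true) ↔ (∃ c' < c, r.a c' = true) ∨ r.a c = true :=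
        Nat.exists_lt_succ_right
      rw [this, ← h15]
      cases r.a c <;> simp
    · simp only [tick_mem, set_mem, put_mem, eval_var]
      rw [hmem]
      simp [h14]
      exact update_overw σ.mem q c fun c => (r.a c).toNat
    · simp at ht ⊢
      omega
  rintro τ hτ ⟨h13, h14, h15, hmem⟩ ht
  simp [h2] at h13 h14 h15 ht hmem
  simp only [tick_fr, set_fr, Nat.reduceLeDiff] at hτ
  refine wp_seq (wp_getBit (L := L) (hI.congr (hτ 0 (by omega)) fun a h => by
    rw [hmem, overw_lt (by omega)]) h13 (by omega) fun t₁ ht₁ => ?_)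
  rw [ha n (by omega)]
  have hover : Function.update (overw σ.mem q n fun c => (r.a c).toNat) (q + n) (r.a n).toNat =
      overw σ.mem q (n + 1) fun c => (r.a c).toNat := update_overw σ.mem q n fun c => (r.a c).toNat
  refine wp_seq (wp_sto (wp_seq (wp_asg (wp_seq ((wp_digitsProg (L := L) (p := p + (n + 1))
    (hI.congr ?_ fun a h => ?_) ?_ (by omega) hd).mono ?_)))))
  · simp [hτ 0]
  · simp only [tick_mem, set_mem, put_mem, eval_var]
    rw [hmem]
    simp [h14]
    rw [hover, overw_lt (by omega)]
  · simp; omega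
  rintro τ₂ ⟨b₁, b₂, b₃, b₄, b₅, b₆⟩
  have c12 : τ₂.v 12 = σ.v 12 := by simp [b₁ 12, hτ 12]
  have c14 : τ₂.v 14 = q + (n + 1) := by simp [b₁ 14, h14]; omega
  have c15 : τ₂.v 15 = τ.v 15 := by simp [b₁ 15]
  have cmem : τ₂.mem = overw σ.mem q (n + 1) fun c => (r.a c).toNat := by
    rw [b₂, ← hover, ← hmem, ← h14]; simp
  have cfr : σ.Fr 12 τ₂ := fun s hs => by
    have h₁ : s ≠ 13 := by omega
    have h₂ : s ≠ 14 := by omega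
    have h₃ : s ≠ 15 := by omega
    have h₄ : s ≠ 16 := by omega
    rw [b₁ s (by omega) h₁]
    simp [h₁, h₂, h₃, h₄, hτ s (by omega)]
  have ct : τ₂.time ≤ σ.time + (40 * n + 60 * L + 160) := by
    simp at b₆ ht₁
    omega
  have hgood : r.Good n ↔ 0 < τ₂.v 15 ∧ 0 < τ₂.v 19 := by
    rw [c15, h15, b₅, RawRow.Good]
    cases r.ds.getLastD false <;> simp
  -- Common ending for the four outcomes of the two final validity tests.
  have fin : ∀ τ : Store, τ₂.Fr 12 τ → τ.v 13 = τ₂.v 13 → τ.v 14 = q + (n + 2) →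
      τ.mem = Function.update τ₂.mem (q + (n + 1)) (ofBin r.ds) →
      (0 < τ.v 12 ↔ 0 < τ₂.v 12 ∨ ¬ (0 < τ₂.v 15 ∧ 0 < τ₂.v 19)) →
      τ.time ≤ τ₂.time + 40 → σ.Fr 12 τ ∧ (0 < τ.v 12 ↔ 0 < σ.v 12 ∨ ¬ r.Good n) ∧
      τ.v 13 = p + (encRow n r).length ∧ τ.v 14 = q + (n + 2) ∧
      (∀ a < q, τ.mem a = σ.mem a) ∧ (∀ c < n + 1, τ.mem (q + c) = (r.a c).toNat) ∧
      τ.mem (q + (n + 1)) = ofBin r.ds ∧ τ.time ≤ σ.time + (40 * n + 60 * L + 200) := by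
    intro τ a₁ a₂ a₃ a₄ a₅ a₆
    refine ⟨cfr.trans a₁ le_rfl, by rw [a₅, c12, hgood], ?_, a₃, fun a h => ?_, fun c h => ?_, ?_,
      by omega⟩
    · rw [a₂, b₃, length_encRow]; omega
    · rw [a₄, Function.update_of_ne (by omega), cmem, overw_lt h]
    · rw [a₄, Function.update_of_ne (by omega), cmem, overw_add h]
    · rw [a₄, Function.update_self]
  refine wp_seq (wp_sto (wp_seq (wp_asg (wp_seq (wp_ite
    (fun h => wp_skip (wp_ite (fun h' => wp_skip (fin _ ?_ ?_ ?_ ?_ ?_ ?_))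
      fun h' => wp_asg (fin _ ?_ ?_ ?_ ?_ ?_ ?_)))
    fun h => wp_asg (wp_ite (fun h' => wp_skip (fin _ ?_ ?_ ?_ ?_ ?_ ?_))
      fun h' => wp_asg (fin _ ?_ ?_ ?_ ?_ ?_ ?_)))))))
  all_goals first
    | (simp; done)
    | (simp [c14]; done)
    | (simp [c14]; omega)
    | (simp [c14, b₄]; done)
    | (simp at h h'; simp [h, h'])

/-- Reads a system and writes it to the cells behind the input; variable 12 becomes positive if there
is something wrong with an equation. -/
def parseProg : Prog :=
  asg 13 (num 1) ;; unaryProg 2 ;; unaryProg 3 ;; asg 12 (num 0) ;; asg 4 (var 0) ;;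
    asg 14 (var 0) ;; loop 11 3 rowProg

theorem length_encSystem (n m : ℕ) (ρ : ℕ → RawRow) :
    (encSystem n m ρ).length = n + 1 + (m + 1 + (encRows n ρ m).length) := by
  simp [encSystem]; omega

theorem exists_rows {L n : ℕ} {B : ℕ → Bool} (hB : ∀ p, L ≤ p → B p = false) (p : ℕ) : ∀ m : ℕ,
    ∃ ρ : ℕ → RawRow, Reads B p (encRows n ρ m) ∧ ∀ j < m, (ρ j).ds.length ≤ L
  | 0 => ⟨fun _ => ⟨fun _ => false, []⟩, trivial, by simp⟩
  | m + 1 => by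
    obtain ⟨ρ, h, h'⟩ := exists_rows (n := n) hB p m
    obtain ⟨ds, hds, hR⟩ := exists_encDigits hB (p + (encRows n ρ m).length + (n + 1))
    let r : RawRow := ⟨fun c => B (p + (encRows n ρ m).length + c), ds⟩
    have e : encRows n (Function.update ρ m r) m = encRows n ρ m := encRows_congr fun j hj => by
      rw [Function.update_of_ne hj.ne]; exact ⟨fun _ _ => rfl, rfl⟩
    refine ⟨Function.update ρ m r, ?_, fun j hj => ?_⟩
    · rw [encRows, reads_append, e, Function.update_self]
      refine ⟨h, reads_append.2 ⟨reads_map_range.2 fun _ _ => rfl, ?_⟩⟩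
      simpa using hR
    · rcases Nat.lt_succ_iff_lt_or_eq.1 hj with hj | rfl
      · rw [Function.update_of_ne hj.ne]; exact h' j hj
      · rw [Function.update_self]; exact hds

theorem reads_prefix {n p m : ℕ} {B : ℕ → Bool} {ρ : ℕ → RawRow} (h : Reads B p (encRows n ρ m))
    {j : ℕ} (hj : j < m) : Reads B (p + (encRows n ρ j).length) (encRow n (ρ j)) := by
  induction m with
  | zero => omega
  | succ m ih =>
    obtain ⟨h₁, h₂⟩ := reads_append.1 h
    rcases Nat.lt_succ_iff_lt_or_eq.1 hj with hj | rfl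
    · exact ih h₁ hj
    · exact h₂

/-- Every input, valid or not, is parsed as some system of rows. Both unary blocks have length at
most `L`, which bounds the time on invalid inputs too. -/
theorem wp_parseProg {L : ℕ} {B : ℕ → Bool} {σ : Store} (hI : Inp L B σ) :
    ∃ n ≤ L, ∃ m ≤ L, ∃ ρ : ℕ → RawRow, Reads B 1 (encSystem n m ρ) ∧
      wp parseProg σ fun τ => τ.v 0 = L ∧ τ.v 2 = n ∧ τ.v 3 = m ∧ τ.v 4 = L ∧
        τ.v 13 = 1 + (encSystem n m ρ).length ∧ (τ.v 12 = 0 ↔ ∀ j < m, (ρ j).Good n) ∧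
        (∀ a < L, τ.mem a = σ.mem a) ∧
        (∀ j < m, (∀ c < n + 1, τ.mem (L + j * (n + 2) + c) = ((ρ j).a c).toNat) ∧
          τ.mem (L + j * (n + 2) + (n + 1)) = ofBin (ρ j).ds) ∧
        τ.time ≤ σ.time + 400 * ((L + 1) * (L + 1)) := by
  obtain ⟨n, hn, hRn⟩ := exists_unary hI.zero 1
  obtain ⟨m, hm, hRm⟩ := exists_unary hI.zero (1 + (n + 1))
  obtain ⟨ρ, hR, hds⟩ := exists_rows (n := n) hI.zero (1 + (n + 1) + (m + 1)) m
  refine ⟨n, hn, m, hm, ρ, reads_append.2 ⟨hRn, reads_append.2 ⟨?_, ?_⟩⟩, ?_⟩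
  · simpa using hRm
  · simpa using hR
  refine wp_seq (wp_asg (wp_seq ?_))
  refine (wp_unaryProg (L := L) (p := 1) (y := 2) ?_ ?_ le_rfl (by omega) (by omega) hRn).mono ?_
  · exact hI.congr (by simp) fun _ _ => rfl
  · simp
  rintro τ₁ ⟨a₁, a₂, a₃, a₄, a₅⟩
  have e0 : τ₁.v 0 = L := by rw [a₄ 0 (by omega) (by omega)]; simpa using hI.len
  have hI₁ : Inp L B τ₁ := hI.congr (e0.trans hI.len.symm) fun _ _ => by rw [a₃]; rfl
  refine wp_seq ((wp_unaryProg (L := L) (p := 1 + (n + 1)) (y := 3) hI₁ a₂ (by omega) (by omega)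
    (by omega) hRm).mono ?_)
  rintro τ₂ ⟨b₁, b₂, b₃, b₄, b₅⟩
  have f0 : τ₂.v 0 = L := (b₄ 0 (by omega) (by omega)).trans e0
  have f2 : τ₂.v 2 = n := (b₄ 2 (by omega) (by omega)).trans a₁
  have fm : τ₂.mem = σ.mem := b₃.trans a₃
  refine wp_seq (wp_asg (wp_seq (wp_asg (wp_seq (wp_asg ?_)))))
  refine wp_loop 11 (40 * n + 60 * L + 200) (fun j v mem =>
    v 13 = 1 + (n + 1) + (m + 1) + (encRows n ρ j).length ∧ v 14 = L + j * (n + 2) ∧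
    (v 12 = 0 ↔ ∀ j' < j, (ρ j').Good n) ∧ (∀ a < L, mem a = σ.mem a) ∧
    (∀ j' < j, (∀ c < n + 1, mem (L + j' * (n + 2) + c) = ((ρ j').a c).toNat) ∧
      mem (L + j' * (n + 2) + (n + 1)) = ofBin (ρ j').ds)) le_rfl (by omega) ?_ ?_ ?_
  · simp [b₂, f0, fm, encRows, Nat.add_assoc]
  · rintro j hj τ hτ hx ⟨h13, h14, h12, low, rows⟩
    simp [b₁] at hj
    have g0 : τ.v 0 = L := by rw [hτ 0 (by omega)]; simp [f0]
    have g2 : τ.v 2 = n := by rw [hτ 2 (by omega)]; simp [f2]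
    refine (wp_rowProg (L := L) (hI.congr (g0.trans hI.len.symm) low) g2 h13 (by omega) h14
      (by omega) (reads_prefix hR hj) (hds j hj)).mono ?_
    rintro τ' ⟨k₁, k₂, k₃, k₄, k₅, k₆, k₇, k₈⟩
    refine ⟨k₁.mono (by omega), (k₁ 11 (by omega)).trans hx, ⟨?_, ?_, ?_, ?_, ?_⟩, k₈⟩
    · simp [k₃, encRows, Nat.add_assoc]
    · simp [k₄]; ring
    · rw [Nat.forall_lt_succ_right, ← h12]
      simp only [ne_eq, Nat.reduceEqDiff, not_false_eq_true, Function.update_of_ne]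
      by_cases hg : (ρ j).Good n
      · simp only [hg, not_true_eq_false, or_false, and_true] at k₂ ⊢
        omega
      · simp only [hg, not_false_eq_true, or_true, iff_true, and_false, iff_false] at k₂ ⊢
        omega
    · intro a ha
      rw [k₅ a (by omega), low a ha]
    · intro j' hj'
      rcases Nat.lt_succ_iff_lt_or_eq.1 hj' with hj' | rfl
      · have := Nat.mul_le_mul_right (n + 2) hj'
        rw [Nat.succ_mul] at this
        obtain ⟨r₁, r₂⟩ := rows j' hj'
        exact ⟨fun c hc => by rw [k₅ _ (by omega), r₁ c hc], by rw [k₅ _ (by omega), r₂]⟩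
      · exact ⟨k₆, k₇⟩
  · rintro τ hτ ⟨h13, h14, h12, low, rows⟩ ht
    simp [b₁] at h13 h12 rows ht
    have g : ∀ r, τ₂.v r = L → r = 0 → τ.v r = L := fun r h hr => by
      subst hr; rw [hτ 0 (by omega)]; simp [h]
    refine ⟨g 0 f0 rfl, ?_, ?_, ?_, ?_, h12, low, ?_, ?_⟩
    · rw [hτ 2 (by omega)]; simp [f2]
    · rw [hτ 3 (by omega)]; simp [b₁]
    · rw [hτ 4 (by omega)]; simp [f0]
    · rw [h13, length_encSystem]; omega
    · intro j hj
      exact ⟨fun c hc => (rows j hj).1 c (by omega), (rows j hj).2⟩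
    · simp at a₅
      have : m * (40 * n + 60 * L + 200 + 8) ≤ L * (100 * L + 208) :=
        Nat.mul_le_mul hm (by omega)
      nlinarith

/-! ### Deciding bit strings -/

/-- Solves the problem for systems given as bit strings. -/
def bitsProg : Prog :=
  parseProg ;; asg 12 (var 12 + (var 13 - var 0) + (var 0 - var 13)) ;;
    ite (var 12) (asg 0 (num 0)) (asg 1 (ld (num 0)) ;; coreProg)

theorem reads_getD {B : ℕ → Bool} : ∀ {l : List Bool} {p : ℕ},
    (∀ i < l.length, B (p + i) = l.getD i false) → Reads B p l
  | [], _, _ => trivial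
  | b :: l, p, h => ⟨by simpa using h 0 (by simp), reads_getD fun i hi => by
      rw [Nat.add_assoc, Nat.add_comm 1]
      simpa using h (i + 1) (by simpa using hi)⟩

theorem rep_of_raw {L n m : ℕ} {mem : ℕ → ℕ} {ρ : ℕ → RawRow} (h : ∀ j < m, (ρ j).Good n)
    (hmem : ∀ j < m, (∀ c < n + 1, mem (L + j * (n + 2) + c) = ((ρ j).a c).toNat) ∧
      mem (L + j * (n + 2) + (n + 1)) = ofBin (ρ j).ds) :
    Rep mem L n m (systemOfRaw n m ρ h).aug (systemOfRaw n m ρ h).wt := by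
  intro j hj
  obtain ⟨h₁, h₂⟩ := hmem j hj
  refine ⟨fun c hc => ?_, ?_⟩
  · rw [h₁ c (by omega)]
    rcases hc.lt_or_eq with hc | rfl
    · cases hb : (ρ j).a c <;> simp [System.aug, systemOfRaw, hj, hc, hb, ZMod.val_one]
    · cases hb : (ρ j).a c <;> simp [System.aug, systemOfRaw, hj, hb, ZMod.val_one]
  · rw [h₂]
    simp [System.wt, systemOfRaw, hj]

theorem bitsProg_answers (x : List Bool) (k : ℕ) :
    ∃ t ≤ 2000 * (x.length + 2) ^ (k + 3),
      bitsProg.Answers (k :: x.map Bool.toNat) t ((x, k) ∈ maxLinAA) := by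
  -- The shift by one accounts for cell `0`, which holds the parameter.
  let B : ℕ → Bool := fun p => x.getD (p - 1) false
  refine answers_of_wp ?_
  generalize hσ : (⟨fun r => if r = 0 then (k :: x.map Bool.toNat).length else 0,
    fun i => (k :: x.map Bool.toNat).getD i 0, 0⟩ : Store) = σ
  have hx : Reads B 1 x := reads_getD fun i _ => by simp [B]
  have hI : Inp (x.length + 1) B σ := by
    subst hσ
    refine ⟨by simp, fun p h₁ h₂ => ?_, fun p hp => ?_⟩
    · obtain ⟨p, rfl⟩ := Nat.exists_eq_add_of_le' h₁
      have : p < x.length := by omega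
      simp [B, this]
    · simp only [B]
      rw [List.getD_eq_default _ _ (by omega)]
  have hk : σ.mem 0 = k := by subst hσ; simp
  have ht : σ.time = 0 := by subst hσ; rfl
  obtain ⟨n, hn, m, hm, ρ, hR, hwp⟩ := wp_parseProg hI
  generalize hL : x.length + 1 = L at *
  have hpow : (L + 1) * (L + 1) ≤ (L + 1) ^ (k + 3) := by
    rw [← pow_two]; exact Nat.pow_le_pow_right (by omega) (by omega)
  have hpos : 1 ≤ (L + 1) ^ (k + 3) := Nat.one_le_pow _ _ (by omega)
  have hL2 : x.length + 2 = L + 1 := by omega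
  rw [hL2]
  refine wp_seq (hwp.mono ?_)
  rintro τ ⟨v0, v2, v3, v4, v13, v12, low, rows, time⟩
  refine wp_seq (wp_asg (wp_ite ?_ ?_))
  · intro h
    refine wp_asg ⟨?_, ?_⟩
    · simp only [tick_v, set_v, Function.update_self, eval_num, lt_irrefl, false_iff]
      rintro ⟨n', m', S, hS, -⟩
      simp only [S.toBits_eq] at hS
      -- If `x` encoded a system, the parser would have found its rows: all good, and ending exactly
      -- where `x` ends. This contradicts the positive flag.
      obtain ⟨rfl, rfl, hρ⟩ := encSystem_unique hR (hS ▸ hx)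
      have hlen : (encSystem n m ρ).length = x.length := by
        rw [hS, encSystem, encSystem, encRows_congr hρ]
      have h12 : τ.v 12 = 0 := v12.2 fun j hj => by
        obtain ⟨⟨c, hc, h₁⟩, h₂⟩ := S.raw_good hj
        obtain ⟨e₁, e₂⟩ := hρ j hj
        exact ⟨⟨c, hc, (e₁ c (by omega)).trans h₁⟩, by rw [e₂, h₂]⟩
      simp [h12, v0, v13] at h
      omega
    · simp
      omega
  · intro h
    -- The two truncated differences vanish together only if reading stopped exactly at the end of
    -- the input.
    have h : τ.v 12 = 0 ∧ τ.v 13 = L := by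
      simp [v0] at h
      omega
    have hgood := v12.1 h.1
    have hlen : (encSystem n m ρ).length = x.length := by omega
    have hxe := hR.unique hx hlen
    refine wp_seq (wp_asg ?_)
    refine (wp_coreProg (k := k) (D := L) (systemOfRaw n m ρ hgood) ?_ ?_ ?_ ?_ ?_).mono ?_
    · simp [low 0 (by omega), hk]
    · simp [v2]
    · simp [v3]
    · simp [v4]
    · simpa using rep_of_raw hgood rows
    · rintro τ' ⟨h₁, h₂⟩
      have hS : x = (systemOfRaw n m ρ hgood).toBits := by
        rw [System.toBits_eq, encSystem, encRows_congr (systemOfRaw_raw hgood), ← hxe, encSystem]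
      refine ⟨h₁.trans ⟨fun h => ⟨n, m, _, hS, h⟩, ?_⟩, ?_⟩
      · rintro ⟨n', m', S, hS', h⟩
        have e₁ := hx
        rw [show x = S.toBits from hS', S.toBits_eq] at e₁
        have e₂ := hx
        rw [hS, System.toBits_eq] at e₂
        obtain ⟨rfl, rfl, e₃⟩ := encSystem_unique e₂ e₁
        rw [System.eq_of_raw e₃]
        exact h
      · simp at h₂
        have b₁ : m ^ min k m ≤ (L + 1) ^ k :=
          (Nat.pow_le_pow_left (by omega) _).trans
            (Nat.pow_le_pow_right (by omega) (min_le_left _ _))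
        have b₂ : m ^ min k m * ((m + 1) * ((n + 1) * (m + 1))) ≤
            (L + 1) ^ k * ((L + 1) * ((L + 1) * (L + 1))) := by
          gcongr
        have b₃ : (L + 1) ^ k * ((L + 1) * ((L + 1) * (L + 1))) = (L + 1) ^ (k + 3) := by ring
        omega

theorem inXP_maxLinAA : InXP maxLinAA := by
  -- The constant 2000 is absorbed by `2 ^ 11 = 2048`, as the base is at least 2; this adds 11 to
  -- the exponent `k + 3`.
  refine ⟨bitsProg, fun k => k + 14,
    (Primrec.nat_add.comp Primrec.id (Primrec.const 14)).to_comp, fun x k => ?_⟩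
  obtain ⟨t, ht, h⟩ := bitsProg_answers x k
  refine ⟨t, h, ht.trans ?_⟩
  have h₁ : 2000 ≤ (x.length + 2) ^ 11 :=
    le_trans (by norm_num) (Nat.pow_le_pow_left (show 2 ≤ x.length + 2 by omega) 11)
  calc 2000 * (x.length + 2) ^ (k + 3) ≤ (x.length + 2) ^ 11 * (x.length + 2) ^ (k + 3) :=
        Nat.mul_le_mul_right _ h₁
    _ = (x.length + 2) ^ (k + 14) := by ring

end MaxLin

theorem mainTheorem7 :
    (∃ (P : MaxLin.Prog) (C c : ℕ), ∀ (n m k : ℕ) (S : MaxLin.System n m), ∃ t : ℕ,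
      P.Answers (k :: S.toWords) t ((k : ℤ) ≤ S.maxExcess) ∧
      (0 < m → t ≤ C * (n ^ c * m ^ (k + c))) ∧
      (0 < m → n ≤ m → t ≤ C * m ^ (k + c))) ∧
    MaxLin.InXP MaxLin.maxLinAA :=
  ⟨MaxLin.exists_prog_toWords, MaxLin.inXP_maxLinAA⟩
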